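/- Let $d\ge 1$ be an integer. A $d$-uniform hypergraph $\mathcal H$ on a finite vertex set $U$ is a set of $d$-element subsets of $U$, called hyperedges; $m(\mathcal H)$ is the number of hyperedges. The GPIS oracle of $\mathcal H$ takes as input $d$ pairwise disjoint sets $A_1,\dots,A_d\subseteq U$ and answers YES if some hyperedge of $\mathcal H$ has exactly one vertex in each of $A_1,\dots,A_d$, and NO otherwise. A (randomized) GPIS algorithm knows $U$, $d$ and its parameters, accesses $\mathcal H$ only by adaptively chosen GPIS queries, and outputs a real number; its cost is the number of queries. Theorem. For every $d\ge1$ and every $c>0$ there is a constant $C=C(d,c)>0$ such that for every finite set $U$ with $n=|U|\ge 2$ and every $\varepsilon\in(0,1)$ there is a randomized GPIS algorithm that makes at most $$C\cdot\frac{(\log n)^{5d+5}}{\varepsilon^4}$$ GPIS queries (on every hypergraph and for every outcome of its random choices) and that, on every $d$-uniform hypergraph $\mathcal H$ with vertex set $U$, outputs with probability at least $1-n^{-c}$ a number $\widehat m$ with $$(1-\varepsilon)\,m(\mathcal H)\le \widehat m\le(1+\varepsilon)\,m(\mathcal H).$$ -/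

import Mathlib

/-- A `d`-uniform hypergraph on the vertex set `V`: a finite set of hyperedges, each of which
consists of exactly `d` vertices. -/
structure UniformHypergraph (V : Type*) (d : ℕ) where
  /-- the set of (unordered) hyperedges -/
  edges : Finset (Finset V)
  /-- every hyperedge consists of exactly `d` vertices -/
  card_eq : ∀ F ∈ edges, F.card = d

namespace UniformHypergraph

/-- `m(H)`, the number of hyperedges of `H`. -/
def numEdges {V : Type*} {d : ℕ} (H : UniformHypergraph V d) : ℕ :=
  H.edges.card

open Classical in
/-- `m(A₁, …, A_d)`, the number of hyperedges of `H` that have exactly one vertex in each `A i`. -/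
noncomputable def numEdgesIn {V : Type*} {d : ℕ} (H : UniformHypergraph V d)
    (A : Fin d → Finset V) : ℕ :=
  (H.edges.filter (fun F => ∀ i, ∃! v, v ∈ F ∧ v ∈ A i)).card

/-- The answer of the generalized `d`-partite independent set oracle on the input `A₁, …, A_d`
(which a querying algorithm has to choose pairwise disjoint): yes iff `m(A₁, …, A_d) ≠ 0`. -/
noncomputable def gpis {V : Type*} {d : ℕ} (H : UniformHypergraph V d)
    (A : Fin d → Finset V) : Bool :=
  decide (H.numEdgesIn A ≠ 0)

end UniformHypergraph

/-- A deterministic adaptive algorithm that knows the vertex set `V` and accesses a `d`-uniform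
hypergraph on `V` only through GPIS queries (a decision tree): it either stops and outputs
a real number, or asks a query consisting of `d` pairwise disjoint vertex sets and continues
according to the answer. -/
inductive GPISAlgorithm (V : Type*) (d : ℕ) where
  | output (x : ℝ) : GPISAlgorithm V d
  | query (A : Fin d → Finset V) (hA : Pairwise fun i j => Disjoint (A i) (A j))
      (ifYes ifNo : GPISAlgorithm V d) : GPISAlgorithm V d

namespace GPISAlgorithm

/-- The output of the algorithm when the queries are answered according to `H`. -/
noncomputable def run {V : Type*} {d : ℕ} (H : UniformHypergraph V d) : GPISAlgorithm V d → ℝ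
  | output x => x
  | query A _ ifYes ifNo => if H.gpis A = true then ifYes.run H else ifNo.run H

/-- The number of queries that the algorithm makes when they are answered according to `H`. -/
noncomputable def numQueries {V : Type*} {d : ℕ} (H : UniformHypergraph V d) :
    GPISAlgorithm V d → ℕ
  | output _ => 0
  | query A _ ifYes ifNo =>
      1 + (if H.gpis A = true then ifYes.numQueries H else ifNo.numQueries H)

end GPISAlgorithm

/-- A randomized GPIS algorithm: a probability distribution on deterministic GPIS algorithms,
equivalently a deterministic algorithm with access to a random string. -/
abbrev RandomizedGPISAlgorithm (V : Type*) (d : ℕ) := PMF (GPISAlgorithm V d)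

namespace RandomizedGPISAlgorithm

/-- The probability, over the random choices of the algorithm, that its output on `H` is
a `(1 ± ε)`-approximation of the number of hyperedges of `H`. -/
noncomputable def successProb {V : Type*} {d : ℕ} (P : RandomizedGPISAlgorithm V d) (ε : ℝ)
    (H : UniformHypergraph V d) : ℝ :=
  (P.toOuterMeasure {T | (1 - ε) * (H.numEdges : ℝ) ≤ T.run H ∧
    T.run H ≤ (1 + ε) * (H.numEdges : ℝ)}).toReal

/-- Whatever the random choices of the algorithm and whatever the hypergraph, it makes at most
`q` queries. -/
def MakesAtMost {V : Type*} {d : ℕ} (P : RandomizedGPISAlgorithm V d) (q : ℝ) : Prop :=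
  ∀ T ∈ P.support, ∀ H : UniformHypergraph V d, (T.numQueries H : ℝ) ≤ q

end RandomizedGPISAlgorithm

/-! The estimator keeps a short weighted list of boxes, a box being `d` disjoint vertex sets. Its
value is the number of tuples with one vertex in each set that form a hyperedge. The list starts
from `N` random colourings, weighted so that the total weighted value has mean `m(H)`. A round
splits every box into `2 ^ d` children by one bit of the vertex codes, drops the children without
hyperedges, and draws `N` boxes with reweighting that leaves the mean unchanged. After about `log n`
rounds every set has at most one vertex, so a single query reads off each value.

The selection probabilities use a crude estimate `X` of the value `m` of a box. It needs neither to
be accurate nor to concentrate. If `E[X + 1] ≤ K₁ m` and `m E[1 / (X + 1)] ≤ K₂`, then resampling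
multiplies the bound on the second moment by only `1 + K₁ K₂ / N` (`expect_resample_sq_le`). So `N`
of order `L K₁ K₂ / ε²` suffices over `L` rounds.

To build `X`, thin the `i`-th set at rate `2 ^ (-s i)` and count `2 ^ ∑ s` if a query still finds a
hyperedge, summing over all shapes `s` and `R` repetitions. The union bound controls the mean. By
`exists_shape` some shape detects a hyperedge with probability at least `2 ^ (-d)` and counts at
least `m / L ^ d`, which controls the inverse moment. Here `K₁` and `K₂` are polylogarithmic in `n`.

Chebyshev's inequality makes one run fail with probability at most `1 / 16`, and the median of
`O(log n)` runs gives failure probability at most `n ^ (-c)`. -/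

open scoped ENNReal NNReal

/-! ### Expectations, independent samples and Chebyshev's inequality -/

namespace PMF

variable {α β ι : Type*}

/-- The expectation of a nonnegative function of a random element with distribution `p`. -/
noncomputable def expect (p : PMF α) (f : α → ℝ≥0∞) : ℝ≥0∞ := ∑' a, p a * f a

theorem expect_pure (a : α) (f : α → ℝ≥0∞) : (PMF.pure a).expect f = f a := by
  classical
  unfold expect
  rw [tsum_eq_single a]
  · simp
  · intro b hb
    simp [hb]

theorem expect_bind {β : Type*} (p : PMF α) (g : α → PMF β) (f : β → ℝ≥0∞) :
    (p.bind g).expect f = p.expect fun a => (g a).expect f := by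
  unfold expect
  simp only [PMF.bind_apply, ← ENNReal.tsum_mul_right, ← ENNReal.tsum_mul_left]
  rw [ENNReal.tsum_comm]
  simp only [mul_assoc]

theorem expect_map (p : PMF α) (g : α → β) (f : β → ℝ≥0∞) :
    (p.map g).expect f = p.expect fun a => f (g a) := by
  rw [PMF.map, expect_bind]
  simp [expect_pure]

theorem expect_const (p : PMF α) (c : ℝ≥0∞) : (p.expect fun _ => c) = c := by
  unfold expect
  rw [ENNReal.tsum_mul_right, p.tsum_coe, one_mul]

theorem expect_add (p : PMF α) (f g : α → ℝ≥0∞) :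
    (p.expect fun a => f a + g a) = p.expect f + p.expect g := by
  unfold expect
  simp only [mul_add]
  exact ENNReal.tsum_add

theorem expect_mul_left (p : PMF α) (c : ℝ≥0∞) (f : α → ℝ≥0∞) :
    (p.expect fun a => c * f a) = c * p.expect f := by
  unfold expect
  rw [← ENNReal.tsum_mul_left]
  congr 1; ext a; ring

theorem expect_mul_right (p : PMF α) (c : ℝ≥0∞) (f : α → ℝ≥0∞) :
    (p.expect fun a => f a * c) = p.expect f * c := by
  simp only [mul_comm _ c, expect_mul_left]

theorem expect_mono (p : PMF α) {f g : α → ℝ≥0∞} (h : ∀ a, f a ≤ g a) :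
    p.expect f ≤ p.expect g :=
  ENNReal.tsum_le_tsum fun a => by gcongr; exact h a

theorem expect_finset_sum (p : PMF α) (s : Finset ι) (f : ι → α → ℝ≥0∞) :
    (p.expect fun a => ∑ i ∈ s, f i a) = ∑ i ∈ s, p.expect (f i) := by
  classical
  induction s using Finset.induction_on with
  | empty => simp [expect_const]
  | insert i s hi ih => simp [Finset.sum_insert hi, expect_add, ih]

theorem expect_uniformOfFintype [Fintype α] [Nonempty α] (f : α → ℝ≥0∞) :
    (PMF.uniformOfFintype α).expect f = (Fintype.card α : ℝ≥0∞)⁻¹ * ∑ a, f a := by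
  unfold expect
  simp [tsum_fintype, Finset.mul_sum]

theorem expect_uniformOfFintype_indicator [Fintype α] [Nonempty α] (q : α → Prop)
    [DecidablePred q] :
    (PMF.uniformOfFintype α).expect (fun a => if q a then 1 else 0) =
      (Fintype.card α : ℝ≥0∞)⁻¹ * ((Finset.univ.filter q).card : ℝ≥0∞) := by
  rw [expect_uniformOfFintype]
  simp

/-- The distribution of a list of independent samples. -/
noncomputable def sequence : List (PMF α) → PMF (List α)
  | [] => PMF.pure []
  | p :: l => p.bind fun a => (sequence l).map (a :: ·)

theorem expect_sequence_cons (p : PMF α) (l : List (PMF α)) (F : List α → ℝ≥0∞) :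
    (sequence (p :: l)).expect F =
      p.expect fun a => (sequence l).expect fun r => F (a :: r) := by
  rw [sequence, expect_bind]
  simp only [expect_map]

theorem expect_sequence_sum (l : List (PMF α)) (f : α → ℝ≥0∞) :
    ((sequence l).expect fun r => (r.map f).sum) = (l.map fun p => p.expect f).sum := by
  induction l with
  | nil => simp [sequence, expect_pure]
  | cons p l ih =>
    simp only [expect_sequence_cons, List.map_cons, List.sum_cons, expect_add, expect_const, ih]

theorem expect_sequence_prod (l : List (PMF α)) (f : α → ℝ≥0∞) :
    ((sequence l).expect fun r => (r.map f).prod) = (l.map fun p => p.expect f).prod := by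
  induction l with
  | nil => simp [sequence, expect_pure]
  | cons p l ih =>
    simp only [expect_sequence_cons, List.map_cons, List.prod_cons, expect_mul_left,
      expect_mul_right, ih]

/-- In the expanded product, terms from two different samples factor by independence. Terms from the
same sample need not, since `f` and `g` may be correlated there; `hfg` supplies exactly this
diagonal bound. -/
theorem expect_sequence_sum_mul_sum_le (l : List ι) (P : ι → PMF α) (f g : α → ℝ≥0∞)
    (u v : ι → ℝ≥0∞) (hf : ∀ i ∈ l, (P i).expect f ≤ u i) (hg : ∀ i ∈ l, (P i).expect g ≤ v i)
    (hfg : ∀ i ∈ l, ((P i).expect fun a => f a * g a) ≤ u i * v i) :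
    ((sequence (l.map P)).expect fun r => (r.map f).sum * (r.map g).sum) ≤
      (l.map u).sum * (l.map v).sum := by
  induction l with
  | nil => simp [sequence, expect_pure]
  | cons i l ih =>
    simp only [List.forall_mem_cons] at hf hg hfg
    have h1 : ((sequence (l.map P)).expect fun r => (r.map f).sum) ≤ (l.map u).sum := by
      rw [expect_sequence_sum, List.map_map]
      exact List.sum_le_sum fun i hi => hf.2 i hi
    have h2 : ((sequence (l.map P)).expect fun r => (r.map g).sum) ≤ (l.map v).sum := by
      rw [expect_sequence_sum, List.map_map]
      exact List.sum_le_sum fun i hi => hg.2 i hi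
    have h3 := ih hf.2 hg.2 hfg.2
    simp only [List.map_cons, expect_sequence_cons, List.sum_cons, add_mul, mul_add, expect_add,
      expect_mul_left, expect_mul_right, expect_const]
    gcongr
    exacts [hfg.1, hg.1, hf.1]

/-- The second moment is the squared mean plus the sum of the variances, and each variance is at
most the second moment of its sample. -/
theorem expect_sequence_sum_sq_le (l : List (PMF α)) (f : α → ℝ≥0∞) :
    ((sequence l).expect fun r => (r.map f).sum ^ 2) ≤
      (l.map fun p => p.expect fun a => f a ^ 2).sum + (l.map fun p => p.expect f).sum ^ 2 := by
  induction l with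
  | nil => simp [sequence, expect_pure]
  | cons p l ih =>
    simp only [List.map_cons, expect_sequence_cons, List.sum_cons]
    have h : ∀ (a : α) (r : List α), (f a + (r.map f).sum) ^ 2 =
        f a ^ 2 + 2 * f a * (r.map f).sum + (r.map f).sum ^ 2 := fun a r => by ring
    simp only [h, expect_add, expect_const, expect_mul_left, expect_mul_right,
      expect_sequence_sum]
    calc _ ≤ (p.expect fun a => f a ^ 2) + 2 * p.expect f * (l.map fun p => p.expect f).sum +
          ((l.map fun p => p.expect fun a => f a ^ 2).sum +
            (l.map fun p => p.expect f).sum ^ 2) := by gcongr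
      _ ≤ (p.expect fun a => f a ^ 2) + 2 * p.expect f * (l.map fun p => p.expect f).sum +
          ((l.map fun p => p.expect fun a => f a ^ 2).sum +
            (l.map fun p => p.expect f).sum ^ 2) + (p.expect f) ^ 2 := le_self_add
      _ = _ := by ring

theorem expect_indicator_add_not (p : PMF α) (q : α → Prop) [DecidablePred q] :
    (p.expect fun a => if q a then 1 else 0) + (p.expect fun a => if q a then 0 else 1) = 1 := by
  rw [← expect_add]
  refine Eq.trans ?_ (expect_const p 1)
  congr 1; ext a
  split_ifs <;> simp

/-- Chebyshev's inequality for a nonnegative random variable with mean `m` and second moment at most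
`(1 + ε² / 16) m²`. -/
theorem chebyshev (p : PMF ℝ≥0) (m : ℝ≥0) (ε : ℝ≥0) (hε : 0 < ε)
    (h1 : (p.expect fun z => (z : ℝ≥0∞)) = m)
    (h2 : (p.expect fun z => (z : ℝ≥0∞) ^ 2) ≤ (1 + ε ^ 2 / 16 : ℝ≥0) * (m : ℝ≥0∞) ^ 2)
    (bad : ℝ≥0 → Prop) [DecidablePred bad]
    (hbad : ∀ z, bad z → (ε : ℝ) * m < |(z : ℝ) - m|) :
    (p.expect fun z => if bad z then 1 else 0) ≤ 16⁻¹ := by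
  -- For mean zero the Markov threshold `ε² m²` degenerates, but then the variable vanishes almost
  -- surely and zero is not bad.
  rcases eq_or_ne m 0 with hm | hm
  · subst hm
    have h0 : (p.expect fun z => if bad z then (1 : ℝ≥0∞) else 0) = 0 := by
      unfold expect at h1 ⊢
      simp only [ENNReal.coe_zero, ENNReal.tsum_eq_zero, mul_eq_zero] at h1 ⊢
      intro z
      rcases h1 z with h | h
      · exact Or.inl h
      · right
        rw [if_neg]
        intro hb
        have := hbad z hb
        rw [ENNReal.coe_eq_zero] at h
        simp [h] at this
    rw [h0]; exact zero_le
  · set D : ℝ≥0 → ℝ≥0 := fun z => Real.toNNReal (((z : ℝ) - m) ^ 2) with hD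
    -- The cross term stays on the left because subtraction in `ℝ≥0∞` is truncated.
    have hDm : ∀ z : ℝ≥0, (D z : ℝ≥0∞) + 2 * m * z = (z : ℝ≥0∞) ^ 2 + (m : ℝ≥0∞) ^ 2 := by
      intro z
      have : D z + 2 * m * z = z ^ 2 + m ^ 2 := by
        apply NNReal.coe_injective
        push_cast
        rw [hD, Real.coe_toNNReal _ (sq_nonneg _)]
        ring
      exact_mod_cast this
    have hE : (p.expect fun z => (D z : ℝ≥0∞)) + 2 * m * m =
        (p.expect fun z => (z : ℝ≥0∞) ^ 2) + (m : ℝ≥0∞) ^ 2 := by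
      have := congrArg (fun f => p.expect f) (funext hDm)
      simpa only [expect_add, expect_mul_left, h1, expect_const] using this
    have hE2 : (p.expect fun z => (D z : ℝ≥0∞)) ≤ ((ε ^ 2 / 16 * m ^ 2 : ℝ≥0) : ℝ≥0∞) := by
      have hfin : (2 * m * m : ℝ≥0∞) ≠ ⊤ := by
        exact_mod_cast ENNReal.coe_ne_top (r := 2 * m * m)
      rw [← ENNReal.add_le_add_iff_right hfin, hE]
      calc _ ≤ ((1 + ε ^ 2 / 16 : ℝ≥0) : ℝ≥0∞) * (m : ℝ≥0∞) ^ 2 + (m : ℝ≥0∞) ^ 2 := by gcongr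
        _ = _ := by
          have : (1 + ε ^ 2 / 16) * m ^ 2 + m ^ 2 = ε ^ 2 / 16 * m ^ 2 + 2 * m * m := by ring
          exact_mod_cast congrArg (fun x : ℝ≥0 => (x : ℝ≥0∞)) this
    have hpos : 0 < ε ^ 2 * m ^ 2 := by positivity
    have hmarkov : ((ε ^ 2 * m ^ 2 : ℝ≥0) : ℝ≥0∞) *
        (p.expect fun z => if bad z then 1 else 0) ≤ p.expect fun z => (D z : ℝ≥0∞) := by
      rw [← expect_mul_left]
      refine expect_mono _ fun z => ?_
      split_ifs with hz
      · rw [mul_one]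
        refine ENNReal.coe_le_coe.2 ?_
        rw [hD, ← NNReal.coe_le_coe, Real.coe_toNNReal _ (sq_nonneg _)]
        push_cast
        have := hbad z hz
        rw [← mul_pow, ← sq_abs ((z : ℝ) - m)]
        gcongr
      · simp
    have h3 := hmarkov.trans hE2
    have h4 : ((ε ^ 2 / 16 * m ^ 2 : ℝ≥0) : ℝ≥0∞) = ((ε ^ 2 * m ^ 2 : ℝ≥0) : ℝ≥0∞) * 16⁻¹ := by
      have : ε ^ 2 / 16 * m ^ 2 = ε ^ 2 * m ^ 2 * 16⁻¹ := by ring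
      rw [this, ENNReal.coe_mul, ENNReal.coe_inv (by norm_num)]
      rfl
    rw [h4] at h3
    exact (ENNReal.mul_le_mul_iff_right (by exact_mod_cast hpos.ne') ENNReal.coe_ne_top).1 h3

end PMF

/-! ### Medians and amplification of the success probability -/

/-- The largest entry `y` such that more than half of the entries are at least `y` works. If `[a,
b]` holds a majority, its smallest entry is a candidate, so `a ≤ y`. If `y > b`, the majority in
`[a, b]` and the majority above `y` would be disjoint. -/
theorem exists_median (l : List ℝ) :
    ∃ y : ℝ, ∀ a b : ℝ, l.length < 2 * l.countP (fun z => a ≤ z ∧ z ≤ b) → a ≤ y ∧ y ≤ b := by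
  classical
  set s : Finset ℝ := l.toFinset.filter
    (fun x => l.length < 2 * l.countP (fun z => x ≤ z)) with hs
  have key : ∀ a b : ℝ, l.length < 2 * l.countP (fun z => a ≤ z ∧ z ≤ b) →
      ∃ x ∈ s, a ≤ x := by
    intro a b h
    have hne : (l.toFinset.filter fun z => a ≤ z ∧ z ≤ b).Nonempty := by
      have : 0 < l.countP (fun z => a ≤ z ∧ z ≤ b) := by omega
      obtain ⟨z, hz, hz'⟩ := List.countP_pos_iff.1 this
      exact ⟨z, by simpa [hz] using hz'⟩
    obtain ⟨hx1, hx2⟩ := Finset.mem_filter.1 (Finset.min'_mem _ hne)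
    set x := Finset.min' _ hne with hx
    refine ⟨x, Finset.mem_filter.2 ⟨hx1, h.trans_le ?_⟩, hx2.1⟩
    gcongr
    refine List.countP_mono_left fun z hz hz' => ?_
    simp only [decide_eq_true_eq] at hz' ⊢
    exact Finset.min'_le _ _ (Finset.mem_filter.2 ⟨List.mem_toFinset.2 hz, hz'⟩)
  by_cases hne : s.Nonempty
  · refine ⟨s.max' hne, fun a b h => ⟨?_, ?_⟩⟩
    · obtain ⟨x, hx, hax⟩ := key a b h
      exact hax.trans (Finset.le_max' _ _ hx)
    · by_contra! hb
      have h1 := (Finset.mem_filter.1 (Finset.max'_mem s hne)).2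
      set y := s.max' hne
      have h2 := List.length_eq_countP_add_countP (fun z => decide (y ≤ z)) (l := l)
      have h3 : l.countP (fun z => a ≤ z ∧ z ≤ b) ≤
          l.countP (fun z => ¬ (decide (y ≤ z) = true)) := by
        refine List.countP_mono_left fun z hz hz' => ?_
        simp only [decide_eq_true_eq] at hz' ⊢
        linarith
      omega
  -- Without a candidate no interval holds a majority, so the value `0` is arbitrary.
  · refine ⟨0, fun a b h => ?_⟩
    obtain ⟨x, hx, _⟩ := key a b h
    exact absurd ⟨x, hx⟩ hne

/-- A median of a list of real numbers. -/
noncomputable def List.median (l : List ℝ) : ℝ := (exists_median l).choose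

theorem List.median_mem (l : List ℝ) (a b : ℝ)
    (h : l.length < 2 * l.countP (fun z => a ≤ z ∧ z ≤ b)) : a ≤ l.median ∧ l.median ≤ b :=
  (exists_median l).choose_spec a b h

-- An exponential moment argument: a good sample gets the factor `1/4` and a bad one `4`, with mean
-- at most `1/4 + 4/16 = 1/2`. If the median is bad, at most half of the samples are good and the
-- product of the factors is at least `1`, so Markov's inequality gives `2 ^ (-k)`.
open Classical in
theorem PMF.expect_median_bad_le (p : PMF ℝ) (a b : ℝ) (k : ℕ)
    (hp : (p.expect fun z => if a ≤ z ∧ z ≤ b then 0 else 1) ≤ 16⁻¹) :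
    ((PMF.sequence (List.replicate k p)).map List.median).expect
      (fun y => if a ≤ y ∧ y ≤ b then 0 else 1) ≤ (2⁻¹ : ℝ≥0∞) ^ k := by
  set f : ℝ → ℝ≥0∞ := fun z => if a ≤ z ∧ z ≤ b then 2⁻¹ * 2⁻¹ else 4 with hf
  have hfp : p.expect f ≤ 2⁻¹ := by
    have h : ∀ z, f z ≤ 2⁻¹ * 2⁻¹ + 4 * (if a ≤ z ∧ z ≤ b then 0 else 1) := by
      intro z
      simp only [hf]
      split_ifs <;> simp
    calc p.expect f ≤ _ := p.expect_mono h
      _ ≤ 2⁻¹ * 2⁻¹ + 4 * 16⁻¹ := by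
        rw [expect_add, expect_const, expect_mul_left]
        gcongr
      _ = 2⁻¹ := by
        rw [← ENNReal.toReal_eq_toReal_iff' (by finiteness) (by finiteness)]
        rw [ENNReal.toReal_add (by finiteness) (by finiteness)]
        norm_num
  have hprod : ∀ r : List ℝ, (if a ≤ r.median ∧ r.median ≤ b then (0 : ℝ≥0∞) else 1) ≤
      (r.map f).prod := by
    intro r
    split_ifs with h
    · simp
    · have h1 : 2 * r.countP (fun z => a ≤ z ∧ z ≤ b) ≤ r.length := by
        by_contra! h2
        exact h (r.median_mem a b h2)
      have h2 : ∀ r : List ℝ, (r.map f).prod * 4 ^ (2 * r.countP (fun z => a ≤ z ∧ z ≤ b)) =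
          4 ^ r.length := by
        intro r
        induction r with
        | nil => simp
        | cons z r ih =>
          rw [List.map_cons, List.prod_cons, List.countP_cons, List.length_cons]
          by_cases hz : a ≤ z ∧ z ≤ b
          · have hz4 : f z * 4 = 1 := by
              simp only [hf, if_pos hz]
              rw [← ENNReal.toReal_eq_toReal_iff' (by finiteness) (by finiteness)]
              norm_num
            simp only [hz, and_self, decide_true, if_true]
            calc _ = (f z * 4) * ((r.map f).prod *
                4 ^ (2 * r.countP (fun z => a ≤ z ∧ z ≤ b))) * 4 := by ring
              _ = _ := by rw [ih, hz4]; ring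
          · have hz4 : f z = 4 := by simp only [hf, if_neg hz]
            simp only [hz, decide_false, Bool.false_eq_true, if_false, hz4]
            calc _ = 4 * ((r.map f).prod *
                4 ^ (2 * r.countP (fun z => a ≤ z ∧ z ≤ b))) := by ring
              _ = _ := by rw [ih]; ring
      have h3 := h2 r
      by_contra! h4
      have h5 : (r.map f).prod * 4 ^ (2 * r.countP (fun z => a ≤ z ∧ z ≤ b)) <
          1 * 4 ^ (2 * r.countP (fun z => a ≤ z ∧ z ≤ b)) :=
        ENNReal.mul_lt_mul_left (by simp) (by finiteness) h4
      rw [h3, one_mul] at h5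
      exact absurd (pow_le_pow_right₀ (by norm_num) h1) (not_le.2 h5)
  rw [expect_map]
  calc _ ≤ _ := expect_mono _ hprod
    _ = (p.expect f) ^ k := by rw [expect_sequence_prod]; simp
    _ ≤ _ := by gcongr

/-! ### Decision trees and composition of randomized query algorithms -/

/-- A deterministic decision tree with GPIS queries and outputs in `α`. -/
inductive DecisionTree (V : Type*) (d : ℕ) (α : Type*) where
  | output (x : α) : DecisionTree V d α
  | query (A : Fin d → Finset V) (hA : Pairwise fun i j => Disjoint (A i) (A j))
      (ifYes ifNo : DecisionTree V d α) : DecisionTree V d α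

namespace DecisionTree

variable {V : Type*} {d : ℕ} {α : Type*}

/-- The output of a decision tree on the hypergraph `H`. -/
noncomputable def run (H : UniformHypergraph V d) : DecisionTree V d α → α
  | output x => x
  | query A _ ifYes ifNo => if H.gpis A = true then ifYes.run H else ifNo.run H

/-- The worst-case number of queries. -/
def depth : DecisionTree V d α → ℕ
  | output _ => 0
  | query _ _ ifYes ifNo => 1 + max ifYes.depth ifNo.depth

/-- All outputs satisfy `q`. -/
def All (q : α → Prop) : DecisionTree V d α → Prop
  | output x => q x
  | query _ _ ifYes ifNo => ifYes.All q ∧ ifNo.All q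

/-- A real-valued decision tree as a GPIS algorithm. -/
def toAlgorithm : DecisionTree V d ℝ → GPISAlgorithm V d
  | output x => .output x
  | query A hA ifYes ifNo => .query A hA ifYes.toAlgorithm ifNo.toAlgorithm

theorem run_toAlgorithm (H : UniformHypergraph V d) (T : DecisionTree V d ℝ) :
    T.toAlgorithm.run H = T.run H := by
  induction T with
  | output x => rfl
  | query A hA y n hy hn => simp [toAlgorithm, run, GPISAlgorithm.run, hy, hn]

theorem numQueries_toAlgorithm_le (H : UniformHypergraph V d) (T : DecisionTree V d ℝ) :
    T.toAlgorithm.numQueries H ≤ T.depth := by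
  induction T with
  | output x => rfl
  | query A hA y n hy hn =>
    simp only [toAlgorithm, GPISAlgorithm.numQueries, depth]
    split_ifs <;> omega

end DecisionTree

/-- The family of distributions `f H` can be sampled by a randomized algorithm that accesses `H`
with at most `q` GPIS queries and whose outputs always satisfy `post`. -/
def Implementable {V : Type*} {d : ℕ} {α : Type*} (q : ℕ) (post : α → Prop)
    (f : UniformHypergraph V d → PMF α) : Prop :=
  ∃ P : PMF (DecisionTree V d α), (∀ T ∈ P.support, T.depth ≤ q ∧ T.All post) ∧
    ∀ H, P.map (DecisionTree.run H) = f H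

namespace Implementable

variable {V : Type*} {d : ℕ} {α β ι : Type*}

theorem const (p : PMF α) (post : α → Prop) (h : ∀ a ∈ p.support, post a) :
    Implementable (V := V) (d := d) 0 post fun _ => p := by
  refine ⟨p.map DecisionTree.output, ?_, fun H => ?_⟩
  · intro T hT
    obtain ⟨a, ha, rfl⟩ := (PMF.mem_support_map_iff _ _ _).1 hT
    exact ⟨le_rfl, h a ha⟩
  · rw [PMF.map_comp]
    exact PMF.map_id p

theorem pure (a : α) (post : α → Prop) (h : post a) :
    Implementable (V := V) (d := d) 0 post fun _ => PMF.pure a :=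
  const _ _ fun b hb => by
    rw [PMF.support_pure, Set.mem_singleton_iff] at hb
    rwa [hb]

theorem gpis (A : Fin d → Finset V) (hA : Pairwise fun i j => Disjoint (A i) (A j)) :
    Implementable 1 (fun _ : Bool => True) fun H => PMF.pure (H.gpis A) := by
  refine ⟨PMF.pure (.query A hA (.output true) (.output false)), ?_, fun H => ?_⟩
  · intro T hT
    rw [PMF.support_pure, Set.mem_singleton_iff] at hT
    subst hT
    simp [DecisionTree.depth, DecisionTree.All]
  · rw [PMF.pure_map]
    congr 1
    simp only [DecisionTree.run]
    cases H.gpis A <;> rfl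

theorem mono {q q' : ℕ} {post post' : α → Prop} {f : UniformHypergraph V d → PMF α}
    (h : Implementable q post f) (hq : q ≤ q') (hp : ∀ a, post a → post' a) :
    Implementable q' post' f := by
  obtain ⟨P, hP, hf⟩ := h
  refine ⟨P, fun T hT => ⟨(hP T hT).1.trans hq, ?_⟩, hf⟩
  have := (hP T hT).2
  clear hT
  induction T with
  | output x => exact hp _ this
  | query A hA y n hy hn => exact ⟨hy this.1, hn this.2⟩

/-- The random continuation is grafted onto every leaf by sampling the two subtrees of each query
independently. A given `H` follows only one branch, so only the marginal law of that branch matters.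
-/
theorem bind_tree {q : ℕ} {post : α → Prop} {post' : β → Prop}
    {g : α → UniformHypergraph V d → PMF β} (hg : ∀ a, post a → Implementable q post' (g a))
    (T : DecisionTree V d α) (hT : T.All post) :
    ∃ Q : PMF (DecisionTree V d β), (∀ T' ∈ Q.support, T'.depth ≤ T.depth + q ∧ T'.All post') ∧
      ∀ H, Q.map (DecisionTree.run H) = g (T.run H) H := by
  induction T with
  | output x =>
    obtain ⟨Q, hQ, h⟩ := hg x hT
    exact ⟨Q, fun T' hT' => ⟨by simpa [DecisionTree.depth] using (hQ T' hT').1, (hQ T' hT').2⟩, h⟩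
  | query A hA y n hy hn =>
    obtain ⟨Qy, hQy, hy⟩ := hy hT.1
    obtain ⟨Qn, hQn, hn⟩ := hn hT.2
    refine ⟨Qy.bind fun y => Qn.map fun n => .query A hA y n, ?_, fun H => ?_⟩
    · intro T' hT'
      obtain ⟨y', hy', h⟩ := (PMF.mem_support_bind_iff _ _ _).1 hT'
      obtain ⟨n', hn', rfl⟩ := (PMF.mem_support_map_iff _ _ _).1 h
      have h1 := hQy y' hy'
      have h2 := hQn n' hn'
      refine ⟨?_, h1.2, h2.2⟩
      simp only [DecisionTree.depth]
      omega
    · rw [PMF.map_bind]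
      simp only [PMF.map_comp, Function.comp_def, DecisionTree.run]
      split_ifs with h
      · rw [← hy]
        simp [PMF.map, Function.comp_def]
      · rw [PMF.bind_const, ← hn]

theorem bind {q q' : ℕ} {post : α → Prop} {post' : β → Prop}
    {f : UniformHypergraph V d → PMF α} {g : α → UniformHypergraph V d → PMF β}
    (hf : Implementable q post f) (hg : ∀ a, post a → Implementable q' post' (g a)) :
    Implementable (q + q') post' fun H => (f H).bind fun a => g a H := by
  classical
  obtain ⟨P, hP, hf⟩ := hf
  obtain ⟨T₀, hT₀⟩ := P.support_nonempty
  obtain ⟨Q₀, -⟩ := bind_tree hg T₀ (hP T₀ hT₀).2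
  have h : ∀ T : DecisionTree V d α, ∃ Q : PMF (DecisionTree V d β), T ∈ P.support →
      (∀ T' ∈ Q.support, T'.depth ≤ T.depth + q' ∧ T'.All post') ∧
        ∀ H, Q.map (DecisionTree.run H) = g (T.run H) H := by
    intro T
    by_cases hT : T ∈ P.support
    · obtain ⟨Q, hQ⟩ := bind_tree hg T (hP T hT).2
      exact ⟨Q, fun _ => hQ⟩
    · exact ⟨Q₀, fun h => absurd h hT⟩
  choose Q hQ using h
  refine ⟨P.bind Q, ?_, fun H => ?_⟩
  · intro T' hT'
    obtain ⟨T, hT, h⟩ := (PMF.mem_support_bind_iff _ _ _).1 hT'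
    have h1 := (hQ T hT).1 T' h
    exact ⟨h1.1.trans (by have := (hP T hT).1; omega), h1.2⟩
  · beta_reduce
    rw [← hf, PMF.map_bind, PMF.bind_map]
    ext b
    simp only [PMF.bind_apply, Function.comp_apply]
    congr 1; ext T
    by_cases hT : T ∈ P.support
    · rw [(hQ T hT).2 H]
    · rw [(PMF.apply_eq_zero_iff _ _).2 hT, zero_mul, zero_mul]

theorem map {q : ℕ} {post : α → Prop} {post' : β → Prop} {f : UniformHypergraph V d → PMF α}
    (hf : Implementable q post f) (g : α → β) (hg : ∀ a, post a → post' (g a)) :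
    Implementable q post' fun H => (f H).map g :=
  hf.bind (q' := 0) fun a ha => pure (g a) post' (hg a ha)

theorem sequence {q : ℕ} {post : α → Prop} {f : ι → UniformHypergraph V d → PMF α}
    (hf : ∀ i, Implementable q post (f i)) (l : List ι) :
    Implementable (l.length * q) (fun r : List α => r.length = l.length)
      fun H => PMF.sequence (l.map fun i => f i H) := by
  induction l with
  | nil => exact (pure ([] : List α) (fun r => r.length = 0) rfl).mono (by simp) fun _ h => h
  | cons i l ih =>
    simp only [List.map_cons, PMF.sequence]
    refine ((hf i).bind fun a _ => ih.map (a :: ·)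
      (post' := fun r => r.length = (i :: l).length) ?_).mono (le_of_eq ?_) fun _ h => h
    · intro r hr
      simp [hr]
    · simp only [List.length_cons]; ring

theorem sequence_replicate {q : ℕ} {post : α → Prop} {f : UniformHypergraph V d → PMF α}
    (hf : Implementable q post f) (k : ℕ) :
    Implementable (k * q) (fun r : List α => r.length = k)
      fun H => PMF.sequence (List.replicate k (f H)) := by
  have := sequence (fun _ : Unit => hf) (List.replicate k ())
  simpa using this

end Implementable

/-! ### Random subsets and the shape lemma -/

namespace PMF

/-- The coordinates of a uniform random function are independent. This serves both the random
subsets, with `κ = Fin (2 ^ j)`, and the random colourings, with `κ = Fin d`. -/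
theorem expect_uniform_pi {V κ : Type*} [Fintype V] [DecidableEq V] [Fintype κ] [DecidableEq κ]
    [Nonempty κ] (N : Finset V) (C : V → Finset κ) :
    (PMF.uniformOfFintype (V → κ)).expect (fun h => if ∀ x ∈ N, h x ∈ C x then 1 else 0) =
      ∏ x ∈ N, ((C x).card : ℝ≥0∞) * (Fintype.card κ : ℝ≥0∞)⁻¹ := by
  rw [expect_uniformOfFintype_indicator]
  have h1 : (Finset.univ.filter fun h : V → κ => ∀ x ∈ N, h x ∈ C x) =
      Fintype.piFinset (fun x => if x ∈ N then C x else Finset.univ) := by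
    ext h
    simp only [Finset.mem_filter, Finset.mem_univ, true_and, Fintype.mem_piFinset]
    refine forall_congr' fun x => ?_
    split_ifs with hx <;> simp [hx]
  rw [h1, Fintype.card_piFinset, Fintype.card_fun]
  push_cast
  rw [ENNReal.inv_pow]
  have h2 : ((Fintype.card κ : ℝ≥0∞)⁻¹) ^ Fintype.card V = ∏ _x : V, (Fintype.card κ : ℝ≥0∞)⁻¹ := by
    simp
  rw [h2, ← Finset.prod_mul_distrib, ← Finset.univ_inter N, ← Finset.prod_ite_mem]
  refine Finset.prod_congr rfl fun x _ => ?_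
  simp only [Finset.univ_inter]
  by_cases hx : x ∈ N
  · rw [if_pos hx, if_pos hx, mul_comm]
  · rw [if_neg hx, if_neg hx, Finset.card_univ]
    exact ENNReal.inv_mul_cancel (by simp) (by simp)

end PMF

/-- A random subset of `V` that contains each element independently with probability `2⁻ʲ`. -/
noncomputable def randomSubset (V : Type*) [Fintype V] [DecidableEq V] (j : ℕ) : PMF (Finset V) :=
  (PMF.uniformOfFintype (V → Fin (2 ^ j))).map fun h => Finset.univ.filter fun x => h x = 0

section

variable {V : Type*} [Fintype V] [DecidableEq V]

theorem expect_mem_randomSubset (j : ℕ) (x : V) :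
    ((randomSubset V j).expect fun S => if x ∈ S then 1 else 0) = (2 ^ j)⁻¹ := by
  rw [randomSubset, PMF.expect_map]
  have := PMF.expect_uniform_pi {x} (fun _ : V => ({0} : Finset (Fin (2 ^ j))))
  simpa using this

/-- The subset misses `N` with probability at most `(1 - 2 ^ (-j)) ^ (2 ^ j) ≤ 1 / e ≤ 1 / 2`. -/
theorem one_half_le_expect_randomSubset (j : ℕ) (N : Finset V) (hN : 2 ^ j ≤ N.card) :
    2⁻¹ ≤ (randomSubset V j).expect fun S => if ∃ x ∈ N, x ∈ S then 1 else 0 := by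
  have hmiss : ((randomSubset V j).expect fun S => if ∃ x ∈ N, x ∈ S then 0 else 1) ≤ 2⁻¹ := by
    rw [randomSubset, PMF.expect_map]
    have := PMF.expect_uniform_pi N (fun _ : V => ({0}ᶜ : Finset (Fin (2 ^ j))))
    have h2 : ∀ h : V → Fin (2 ^ j),
        (if ∃ x ∈ N, x ∈ Finset.univ.filter fun x => h x = 0 then (0 : ℝ≥0∞) else 1) =
        if ∀ x ∈ N, h x ∈ ({0}ᶜ : Finset (Fin (2 ^ j))) then 1 else 0 := by
      intro h
      by_cases h' : ∃ x ∈ N, h x = 0 <;> simp [h']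
    simp only [h2]
    rw [this, Finset.prod_const, Finset.card_compl, Finset.card_singleton, Fintype.card_fin]
    have hle : (((2 ^ j - 1 : ℕ) : ℝ≥0∞) * ((2 ^ j : ℕ) : ℝ≥0∞)⁻¹) ≤ 1 := by
      rw [← div_eq_mul_inv]
      refine ENNReal.div_le_of_le_mul ?_
      rw [one_mul]
      exact_mod_cast Nat.sub_le _ _
    refine (pow_le_pow_right_of_le_one' hle hN).trans ?_
    rw [← ENNReal.toReal_le_toReal (by finiteness) (by finiteness)]
    simp only [ENNReal.toReal_pow, ENNReal.toReal_mul, ENNReal.toReal_inv, ENNReal.toReal_natCast,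
      ENNReal.toReal_ofNat]
    rw [Nat.cast_sub Nat.one_le_two_pow]
    push_cast
    set D : ℝ := 2 ^ j with hD
    have hDp : 0 < D := by positivity
    have hD1 : 1 ≤ D := one_le_pow₀ (by norm_num)
    have h3 : (D - 1) * D⁻¹ ≤ Real.exp (-D⁻¹) := by
      have := Real.add_one_le_exp (-D⁻¹)
      have h4 : (D - 1) * D⁻¹ = -D⁻¹ + 1 := by field_simp; ring
      linarith
    calc ((D - 1) * D⁻¹) ^ 2 ^ j ≤ (Real.exp (-D⁻¹)) ^ 2 ^ j := by
          refine pow_le_pow_left₀ (mul_nonneg (by linarith) (by positivity)) h3 _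
      _ = Real.exp (-1) := by
          rw [← Real.exp_nat_mul]
          push_cast
          rw [← hD]
          field_simp
      _ ≤ 2⁻¹ := by
          rw [Real.exp_neg]
          have := Real.add_one_le_exp 1
          gcongr
          linarith
  have h := PMF.expect_indicator_add_not (randomSubset V j) (fun S => ∃ x ∈ N, x ∈ S)
  have h1 : (1 : ℝ≥0∞) ≤
      ((randomSubset V j).expect fun S => if ∃ x ∈ N, x ∈ S then 1 else 0) + 2⁻¹ := by
    refine h.symm.trans_le ?_
    gcongr
  nth_rewrite 1 [← ENNReal.inv_two_add_inv_two] at h1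
  exact (ENNReal.add_le_add_iff_right (by simp)).1 h1

variable (V) in
/-- Independent random subsets `S i` with inclusion probabilities `2 ^ (-s i)`. -/
noncomputable def randomSubsets : (d : ℕ) → (Fin d → ℕ) → PMF (Fin d → Finset V)
  | 0, _ => PMF.pure fun i => i.elim0
  | d + 1, s => (randomSubsets d (Fin.tail s)).bind fun r =>
      (randomSubset V (s 0)).map fun S => Fin.cons S r

theorem expect_mem_randomSubsets (d : ℕ) (s : Fin d → ℕ) (v : Fin d → V) :
    ((randomSubsets V d s).expect fun S => if ∀ i, v i ∈ S i then 1 else 0) =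
      (2 ^ (∑ i, s i))⁻¹ := by
  induction d with
  | zero => simp [randomSubsets, PMF.expect_pure]
  | succ d ih =>
    have h : ∀ (S : Finset V) (r : Fin d → Finset V),
        (if ∀ i, v i ∈ (Fin.cons S r : Fin (d + 1) → Finset V) i then (1 : ℝ≥0∞) else 0) =
          (if v 0 ∈ S then 1 else 0) * (if ∀ i, Fin.tail v i ∈ r i then 1 else 0) := by
      intro S r
      simp only [Fin.forall_fin_succ, Fin.cons_zero, Fin.cons_succ, Fin.tail]
      by_cases h1 : v 0 ∈ S <;> simp [h1]
      congr
    simp only [randomSubsets, PMF.expect_bind, PMF.expect_map, h, PMF.expect_mul_right,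
      expect_mem_randomSubset, PMF.expect_mul_left, ih]
    rw [Fin.sum_univ_succ, pow_add, ENNReal.mul_inv (by simp) (by simp)]
    rfl

theorem expect_hits_randomSubsets_le (d : ℕ) (s : Fin d → ℕ) (M : Finset (Fin d → V)) :
    ((randomSubsets V d s).expect fun S => if ∃ v ∈ M, ∀ i, v i ∈ S i then 1 else 0) ≤
      (M.card : ℝ≥0∞) * (2 ^ (∑ i, s i))⁻¹ := by
  calc _ ≤ (randomSubsets V d s).expect fun S => ∑ v ∈ M, if ∀ i, v i ∈ S i then 1 else 0 := by
        refine PMF.expect_mono _ fun S => ?_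
        split_ifs with h
        · obtain ⟨v, hv, h⟩ := h
          refine le_trans ?_ (Finset.single_le_sum (fun _ _ => zero_le) hv)
          rw [if_pos h]
        · exact zero_le
    _ = _ := by
        rw [PMF.expect_finset_sum]
        simp [expect_mem_randomSubsets]

theorem le_sum_two_pow_indicator (L N : ℕ) (hN : N < 2 ^ L) :
    N ≤ ∑ j : Fin L, 2 ^ (j : ℕ) * (if 2 ^ (j : ℕ) ≤ N then 1 else 0) := by
  -- Truncating at `2 ^ L - 1` gives a form that passes through the induction on the number of
  -- levels.
  have h : ∀ L, min N (2 ^ L - 1) ≤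
      ∑ j ∈ Finset.range L, 2 ^ j * (if 2 ^ j ≤ N then 1 else 0) := by
    intro L
    induction L with
    | zero => simp
    | succ L ih =>
      rw [Finset.sum_range_succ, pow_succ]
      split_ifs with h <;> omega
  have := h L
  rw [Finset.sum_range] at this
  omega

/-- Every nonempty set `M` of tuples has a shape `s` such that `2 ^ ∑ s` is at least `|M|` up to
a factor `L ^ d` and random subsets of shape `s` still contain a tuple of `M` with probability at
least `2 ^ (-d)`. -/
theorem exists_shape (L : ℕ) (hL : Fintype.card V < 2 ^ L) (d : ℕ) (M : Finset (Fin d → V))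
    (hM : M.Nonempty) : ∃ s : Fin d → Fin L, M.card ≤ L ^ d * 2 ^ (∑ i, (s i : ℕ)) ∧
      2⁻¹ ^ d ≤ (randomSubsets V d fun i => (s i : ℕ)).expect
        fun S => if ∃ v ∈ M, ∀ i, v i ∈ S i then 1 else 0 := by
  induction d with
  | zero =>
    refine ⟨fun i => i.elim0, ?_, ?_⟩
    · simpa using Finset.card_le_one_of_subsingleton M
    · obtain ⟨v, hv⟩ := hM
      have : ∃ v, v ∈ M := ⟨v, hv⟩
      simp [randomSubsets, PMF.expect_pure, this]
  | succ d ih =>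
    -- `nb t` is the set of first entries that extend the tail `t` to a tuple of `M`, and `Hv j`
    -- collects the tails with at least `2 ^ j` extensions.
    set nb : (Fin d → V) → Finset V := fun t =>
      Finset.univ.filter fun x => (Fin.cons x t : Fin (d + 1) → V) ∈ M with hnb
    set Hv : Fin L → Finset (Fin d → V) := fun j =>
      Finset.univ.filter fun t => 2 ^ (j : ℕ) ≤ (nb t).card with hHv
    have hcard : M.card = ∑ t, (nb t).card := by
      have h1 : M.card = ∑ t : Fin d → V, (M.filter fun v => Fin.tail v = t).card :=
        Finset.card_eq_sum_card_fiberwise fun _ _ => Finset.mem_coe.2 (Finset.mem_univ _)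
      rw [h1]
      refine Finset.sum_congr rfl fun t _ => ?_
      refine Finset.card_nbij' (fun v => v 0) (fun x => Fin.cons x t) ?_ ?_ ?_ ?_
      · rintro v hv
        obtain ⟨hv, rfl⟩ := Finset.mem_filter.1 hv
        simpa [hnb] using hv
      · intro x hx
        simpa [hnb] using hx
      · rintro v hv
        obtain ⟨hv, rfl⟩ := Finset.mem_filter.1 hv
        simp
      · intro x hx
        simp
    have hsum : M.card ≤ ∑ j : Fin L, 2 ^ (j : ℕ) * (Hv j).card := by
      rw [hcard]
      calc _ ≤ ∑ t, ∑ j : Fin L, 2 ^ (j : ℕ) * (if 2 ^ (j : ℕ) ≤ (nb t).card then 1 else 0) :=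
            Finset.sum_le_sum fun t _ =>
              le_sum_two_pow_indicator L _ ((Finset.card_le_univ _).trans_lt hL)
        _ = _ := by
            rw [Finset.sum_comm]
            refine Finset.sum_congr rfl fun j _ => ?_
            rw [← Finset.mul_sum, Finset.sum_boole, Nat.cast_id]
    have hMp := hM.card_pos
    -- Pigeonhole over the `L` dyadic levels: one level carries at least a `1 / L` share. Its heavy
    -- tails enter the induction and `j` becomes the first rate.
    obtain ⟨j, hj⟩ : ∃ j : Fin L, M.card ≤ L * (2 ^ (j : ℕ) * (Hv j).card) := by
      by_contra! h
      have h1 : ∑ j : Fin L, L * (2 ^ (j : ℕ) * (Hv j).card) ≤ ∑ j : Fin L, (M.card - 1) :=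
        Finset.sum_le_sum fun j _ => Nat.le_sub_one_of_lt (h j)
      rw [← Finset.mul_sum] at h1
      simp only [Finset.sum_const, Finset.card_univ, Fintype.card_fin, smul_eq_mul] at h1
      have hLpos : 0 < L := by
        by_contra! h0
        obtain rfl : L = 0 := by omega
        simp at hsum
        simp [hsum] at hMp
      have h2 := le_of_mul_le_mul_left h1 hLpos
      omega
    have hne : (Hv j).Nonempty := by
      rw [← Finset.card_pos]
      by_contra! h0
      obtain h0 : (Hv j).card = 0 := by omega
      rw [h0] at hj
      omega
    obtain ⟨s, hs, hp⟩ := ih (Hv j) hne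
    refine ⟨Fin.cons j s, ?_, ?_⟩
    · rw [Fin.sum_univ_succ]
      simp only [Fin.cons_zero, Fin.cons_succ]
      calc M.card ≤ L * (2 ^ (j : ℕ) * (Hv j).card) := hj
        _ ≤ L * (2 ^ (j : ℕ) * (L ^ d * 2 ^ (∑ i, (s i : ℕ)))) := by gcongr
        _ = _ := by ring
    · have htail : (Fin.tail fun i => ((Fin.cons j s : Fin (d + 1) → Fin L) i : ℕ)) =
          fun i => (s i : ℕ) := by
        ext i; simp [Fin.tail]
      simp only [randomSubsets, PMF.expect_bind, PMF.expect_map, htail, Fin.cons_zero]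
      -- With probability at least `2 ^ (-d)` the other subsets contain a heavy tail `t`; the
      -- independent first subset then meets `nb t` with probability at least `1 / 2`.
      calc (2⁻¹ : ℝ≥0∞) ^ (d + 1) = 2⁻¹ ^ d * 2⁻¹ := pow_succ _ _
        _ ≤ ((randomSubsets V d fun i => (s i : ℕ)).expect
            fun S => if ∃ v ∈ Hv j, ∀ i, v i ∈ S i then 1 else 0) * 2⁻¹ := by gcongr
        _ = (randomSubsets V d fun i => (s i : ℕ)).expect
            fun S => (if ∃ v ∈ Hv j, ∀ i, v i ∈ S i then 1 else 0) * 2⁻¹ :=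
          (PMF.expect_mul_right _ _ _).symm
        _ ≤ _ := by
          refine PMF.expect_mono _ fun r => ?_
          split_ifs with h
          · obtain ⟨t, ht, htr⟩ := h
            rw [one_mul]
            refine (one_half_le_expect_randomSubset j (nb t) (Finset.mem_filter.1 ht).2).trans ?_
            refine PMF.expect_mono _ fun S => ?_
            split_ifs with h1 h2 h2
            · exact le_rfl
            · exfalso
              obtain ⟨x, hx, hxS⟩ := h1
              refine h2 ⟨Fin.cons x t, (Finset.mem_filter.1 hx).2, fun i => ?_⟩
              refine Fin.cases ?_ (fun i => ?_) i
              · simpa using hxS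
              · simpa using htr i
            · exact zero_le
            · exact le_rfl
          · simp

end

/-! ### Hyperedges as tuples and the crude estimate -/

namespace UniformHypergraph

variable {V : Type*} [DecidableEq V] {d : ℕ}

/-- The tuples `v` with `v i ∈ A i` whose entries form a hyperedge. -/
def tuples (H : UniformHypergraph V d) (A : Fin d → Finset V) : Finset (Fin d → V) :=
  (Fintype.piFinset A).filter fun v => Finset.univ.image v ∈ H.edges

theorem mem_tuples {H : UniformHypergraph V d} {A : Fin d → Finset V} {v : Fin d → V} :
    v ∈ H.tuples A ↔ (∀ i, v i ∈ A i) ∧ Finset.univ.image v ∈ H.edges := by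
  simp [tuples]

/-- Representatives chosen from disjoint sets are distinct, so `d` of them exhaust a hyperedge of
size `d`; conversely disjointness makes each entry of a tuple the only one in its set. -/
theorem gpis_eq_true_iff (H : UniformHypergraph V d) (A : Fin d → Finset V)
    (hA : Pairwise fun i j => Disjoint (A i) (A j)) :
    H.gpis A = true ↔ (H.tuples A).Nonempty := by
  classical
  rw [gpis, decide_eq_true_iff, numEdgesIn, Finset.card_ne_zero]
  have key : ∀ {i j : Fin d} {x : V}, x ∈ A i → x ∈ A j → i = j := by
    intro i j x hi hj
    by_contra hij
    exact Finset.disjoint_left.1 (hA hij) hi hj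
  constructor
  · rintro ⟨F, hF⟩
    obtain ⟨hF, hF'⟩ := Finset.mem_filter.1 hF
    choose v hv hu using hF'
    have hinj : Function.Injective v := fun i j hij =>
      key (hv i).2 (by rw [hij]; exact (hv j).2)
    have himage : Finset.univ.image v = F := by
      refine Finset.eq_of_subset_of_card_le ?_ ?_
      · intro x hx
        obtain ⟨i, -, rfl⟩ := Finset.mem_image.1 hx
        exact (hv i).1
      · rw [H.card_eq F hF, Finset.card_image_of_injective _ hinj]
        simp
    exact ⟨v, mem_tuples.2 ⟨fun i => (hv i).2, himage ▸ hF⟩⟩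
  · rintro ⟨v, hv⟩
    obtain ⟨hv, hF⟩ := mem_tuples.1 hv
    refine ⟨Finset.univ.image v, Finset.mem_filter.2 ⟨hF, fun i => ⟨v i, ⟨by simp, hv i⟩, ?_⟩⟩⟩
    rintro x ⟨hx, hxi⟩
    obtain ⟨j, -, rfl⟩ := Finset.mem_image.1 hx
    rw [key (hv j) hxi]

theorem pairwise_disjoint_inter {A : Fin d → Finset V}
    (hA : Pairwise fun i j => Disjoint (A i) (A j)) (S : Fin d → Finset V) :
    Pairwise fun i j => Disjoint (A i ∩ S i) (A j ∩ S j) :=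
  fun _ _ hij => (hA hij).mono Finset.inter_subset_left Finset.inter_subset_left

variable [Fintype V]

theorem card_tuples_le (H : UniformHypergraph V d) (A : Fin d → Finset V) :
    (H.tuples A).card ≤ Fintype.card V ^ d :=
  (Finset.card_le_univ _).trans (by simp)

/-- The tuples with image `F` are the bijections `Fin d ≃ F`. -/
theorem card_tuples_univ (H : UniformHypergraph V d) :
    (H.tuples fun _ => Finset.univ).card = d.factorial * H.numEdges := by
  have h1 : (H.tuples fun _ => Finset.univ).card = ∑ F ∈ H.edges,
      ((H.tuples fun _ => Finset.univ).filter fun v => Finset.univ.image v = F).card :=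
    Finset.card_eq_sum_card_fiberwise fun v hv => (mem_tuples.1 hv).2
  rw [h1, numEdges, mul_comm, ← smul_eq_mul, ← Finset.sum_const]
  refine Finset.sum_congr rfl fun F hF => ?_
  have hc := H.card_eq F hF
  have e : Fin d ≃ F := (Fintype.equivFinOfCardEq (by simpa using hc)).symm
  have hd : d.factorial = (Finset.univ : Finset (Fin d ≃ F)).card := by
    rw [Finset.card_univ, Fintype.card_equiv e, Fintype.card_fin]
  rw [hd]
  symm
  refine Finset.card_bij (fun (σ : Fin d ≃ F) _ i => (σ i : V)) ?_ ?_ ?_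
  · intro σ _
    have himage : (Finset.univ.image fun i => (σ i : V)) = F := by
      ext x
      simp only [Finset.mem_image, Finset.mem_univ, true_and]
      constructor
      · rintro ⟨i, rfl⟩
        exact (σ i).2
      · intro hx
        exact ⟨σ.symm ⟨x, hx⟩, by simp⟩
    refine Finset.mem_filter.2 ⟨mem_tuples.2 ⟨by simp, ?_⟩, himage⟩
    rw [himage]; exact hF
  · intro σ _ τ _ h
    ext i
    exact congrFun h i
  · intro v hv
    obtain ⟨-, hv⟩ := Finset.mem_filter.1 hv
    have hmem : ∀ i, v i ∈ F := fun i => by rw [← hv]; simp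
    have hinj : Function.Injective v := by
      have : (Finset.univ.image v).card = (Finset.univ : Finset (Fin d)).card := by
        rw [hv, hc]; simp
      simpa using Finset.card_image_iff.1 this
    refine ⟨Equiv.ofBijective (fun i => (⟨v i, hmem i⟩ : F)) ?_, Finset.mem_univ _, rfl⟩
    rw [Fintype.bijective_iff_injective_and_card]
    refine ⟨fun i j h => hinj (by simpa using h), by simpa using hc.symm⟩

/-- One sample of shape `s`: `2 ^ ∑ s` if the random subsets of `A` still span a hyperedge. -/
noncomputable def shapeSample (H : UniformHypergraph V d) (A : Fin d → Finset V)
    (s : Fin d → ℕ) : PMF ℕ :=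
  (randomSubsets V d s).bind fun S =>
    (PMF.pure (H.gpis fun i => A i ∩ S i)).map fun b => if b then 2 ^ (∑ i, s i) else 0

/-- A crude randomized estimate for the number of hyperedges in `A`: the sum of `R` samples of every
shape. -/
noncomputable def crudeEstimate (H : UniformHypergraph V d) (R L : ℕ) (A : Fin d → Finset V) :
    PMF ℕ :=
  (PMF.sequence ((List.replicate R (Finset.univ : Finset (Fin d → Fin L)).toList).flatten.map
    fun s => H.shapeSample A fun i => (s i : ℕ))).map List.sum

theorem implementable_shapeSample (A : Fin d → Finset V)
    (hA : Pairwise fun i j => Disjoint (A i) (A j)) (s : Fin d → ℕ) :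
    Implementable 1 (fun _ => True) fun H => H.shapeSample A s := by
  have := (Implementable.const (V := V) (d := d) (randomSubsets V d s) (fun _ => True)
    fun _ _ => trivial).bind fun S _ =>
      (Implementable.gpis _ (pairwise_disjoint_inter hA S)).map
        (fun b => if b then 2 ^ (∑ i, s i) else 0) (post' := fun _ => True) fun _ _ => trivial
  exact this.mono (by simp) fun _ _ => trivial

theorem implementable_crudeEstimate (R L : ℕ) (A : Fin d → Finset V)
    (hA : Pairwise fun i j => Disjoint (A i) (A j)) :
    Implementable (R * L ^ d) (fun _ => True) fun H => H.crudeEstimate R L A := by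
  refine ((Implementable.sequence (fun s : Fin d → Fin L => implementable_shapeSample A hA
    fun i => (s i : ℕ)) _).map List.sum (post' := fun _ => True) fun _ _ => trivial).mono
      ?_ fun _ _ => trivial
  simp

theorem expect_shapeSample (H : UniformHypergraph V d) (A : Fin d → Finset V)
    (hA : Pairwise fun i j => Disjoint (A i) (A j)) (s : Fin d → ℕ) (f : ℕ → ℝ≥0∞) :
    (H.shapeSample A s).expect f = (randomSubsets V d s).expect fun S =>
      if ∃ v ∈ H.tuples A, ∀ i, v i ∈ S i then f (2 ^ (∑ i, s i)) else f 0 := by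
  rw [shapeSample, PMF.expect_bind]
  congr 1; ext S
  have h : (H.gpis fun i => A i ∩ S i) = true ↔ ∃ v ∈ H.tuples A, ∀ i, v i ∈ S i := by
    rw [gpis_eq_true_iff H _ (pairwise_disjoint_inter hA S)]
    constructor
    · rintro ⟨v, hv⟩
      obtain ⟨hv, hF⟩ := mem_tuples.1 hv
      exact ⟨v, mem_tuples.2 ⟨fun i => (Finset.mem_inter.1 (hv i)).1, hF⟩,
        fun i => (Finset.mem_inter.1 (hv i)).2⟩
    · rintro ⟨v, hv, hS⟩
      obtain ⟨hv, hF⟩ := mem_tuples.1 hv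
      exact ⟨v, mem_tuples.2 ⟨fun i => Finset.mem_inter.2 ⟨hv i, hS i⟩, hF⟩⟩
  rw [PMF.expect_map, PMF.expect_pure]
  simp only [h]
  split_ifs <;> rfl

theorem natCast_sum_list (l : List ℕ) :
    ((l.sum : ℕ) : ℝ≥0∞) = (l.map fun x : ℕ => (x : ℝ≥0∞)).sum := by
  induction l with
  | nil => simp
  | cons x l ih => simp [ih]

/-- For each shape the reported value `2 ^ ∑ s` cancels the survival probability of a tuple in the
union bound, so each of the `R * L ^ d` samples has mean at most the number of tuples. -/
theorem expect_crudeEstimate_le (H : UniformHypergraph V d) (R L : ℕ) (A : Fin d → Finset V)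
    (hA : Pairwise fun i j => Disjoint (A i) (A j)) :
    ((H.crudeEstimate R L A).expect fun x => (x : ℝ≥0∞)) ≤
      (R * L ^ d : ℕ) * ((H.tuples A).card : ℝ≥0∞) := by
  rw [crudeEstimate, PMF.expect_map]
  simp only [natCast_sum_list]
  rw [PMF.expect_sequence_sum, List.map_map]
  refine (List.sum_le_card_nsmul _ ((H.tuples A).card : ℝ≥0∞) ?_).trans (le_of_eq ?_)
  · intro x hx
    obtain ⟨s, -, rfl⟩ := List.mem_map.1 hx
    simp only [Function.comp_apply]
    rw [expect_shapeSample H A hA]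
    calc _ = 2 ^ (∑ i, (s i : ℕ)) * (randomSubsets V d fun i => (s i : ℕ)).expect fun S =>
          if ∃ v ∈ H.tuples A, ∀ i, v i ∈ S i then 1 else 0 := by
          rw [← PMF.expect_mul_left]
          congr 1; ext S
          split_ifs <;> simp
      _ ≤ 2 ^ (∑ i, (s i : ℕ)) * ((H.tuples A).card * (2 ^ (∑ i, (s i : ℕ)))⁻¹) := by
          gcongr
          exact expect_hits_randomSubsets_le _ _ _
      _ = (H.tuples A).card := by
          rw [mul_comm, mul_assoc, ENNReal.inv_mul_cancel (by simp) (by finiteness), mul_one]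
  · simp

/-- For the shape from `exists_shape`, one hit already makes the estimate at least `M`, contributing
at most `L ^ d`. All `R` repetitions miss with probability at most `(1 - 2 ^ (-d)) ^ R`, which by
`hR` outweighs even `n ^ d` tuples and contributes at most `1`. -/
theorem expect_inv_crudeEstimate_le (H : UniformHypergraph V d) (R L : ℕ)
    (hL : Fintype.card V < 2 ^ L) (hR : (1 - 2⁻¹ ^ d : ℝ≥0∞) ^ R * (Fintype.card V : ℝ≥0∞) ^ d ≤ 1)
    (A : Fin d → Finset V) (hA : Pairwise fun i j => Disjoint (A i) (A j)) :
    ((H.tuples A).card : ℝ≥0∞) *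
      ((H.crudeEstimate R L A).expect fun x => ((x + 1 : ℕ) : ℝ≥0∞)⁻¹) ≤ (L ^ d + 1 : ℕ) := by
  rcases (H.tuples A).eq_empty_or_nonempty with h0 | hne
  · simp [h0]
  obtain ⟨s, hs, hp⟩ := exists_shape L hL d _ hne
  set M := 2 ^ (∑ i, (s i : ℕ)) with hM
  have hmiss : ((H.crudeEstimate R L A).expect fun x => if x < M then 1 else 0) ≤
      (1 - 2⁻¹ ^ d) ^ R := by
    rw [crudeEstimate, PMF.expect_map]
    have hlt : ∀ l : List ℕ, (if l.sum < M then (1 : ℝ≥0∞) else 0) ≤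
        (l.map fun x => if x < M then (1 : ℝ≥0∞) else 0).prod := by
      intro l
      induction l with
      | nil => simp only [List.map_nil, List.prod_nil]; split_ifs <;> simp
      | cons x l ih =>
        rw [List.map_cons, List.prod_cons, List.sum_cons]
        split_ifs with h1 h2 h2
        · rw [one_mul]
          refine le_trans ?_ ih
          rw [if_pos (by omega)]
        · omega
        · exact zero_le
        · exact zero_le
    refine (PMF.expect_mono _ hlt).trans ?_
    rw [PMF.expect_sequence_prod, List.map_map, List.map_flatten, List.prod_flatten,
      List.map_replicate, List.map_replicate, List.prod_replicate, Finset.prod_map_toList]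
    gcongr
    -- Only the shape `s` matters; the factors of all other shapes are bounded by `1`.
    rw [← Finset.mul_prod_erase _ _ (Finset.mem_univ s)]
    refine (mul_le_of_le_one_right' (Finset.prod_le_one' fun s' _ => ?_)).trans ?_
    · refine (PMF.expect_mono _ (g := fun _ => 1) fun x => ?_).trans (PMF.expect_const _ _).le
      split_ifs <;> simp
    · simp only [Function.comp_apply]
      rw [expect_shapeSample H A hA]
      simp only [← hM, lt_irrefl, if_false]
      have h0M : 0 < M := by positivity
      simp only [h0M, if_true]
      have h := PMF.expect_indicator_add_not (randomSubsets V d fun i => (s i : ℕ))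
        fun S => ∃ v ∈ H.tuples A, ∀ i, v i ∈ S i
      refine ENNReal.le_sub_of_add_le_left (by finiteness) ?_
      refine (add_le_add_left hp _).trans (le_of_eq ?_)
      exact h
  have hinv : ∀ x : ℕ, ((x + 1 : ℕ) : ℝ≥0∞)⁻¹ ≤ (M : ℝ≥0∞)⁻¹ + if x < M then 1 else 0 := by
    intro x
    split_ifs with h
    · refine le_trans ?_ le_add_self
      rw [ENNReal.inv_le_one]
      exact_mod_cast Nat.le_add_left 1 x
    · rw [add_zero]
      gcongr
      omega
  calc _ ≤ ((H.tuples A).card : ℝ≥0∞) * ((M : ℝ≥0∞)⁻¹ + (1 - 2⁻¹ ^ d) ^ R) := by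
        gcongr
        refine (PMF.expect_mono _ hinv).trans ?_
        rw [PMF.expect_add, PMF.expect_const]
        gcongr
    _ = ((H.tuples A).card : ℝ≥0∞) * (M : ℝ≥0∞)⁻¹ +
        (1 - 2⁻¹ ^ d) ^ R * ((H.tuples A).card : ℝ≥0∞) := by ring
    _ ≤ (L ^ d : ℕ) * M * (M : ℝ≥0∞)⁻¹ + (1 - 2⁻¹ ^ d) ^ R * (Fintype.card V : ℝ≥0∞) ^ d := by
        gcongr
        · exact_mod_cast hs
        · exact_mod_cast H.card_tuples_le A
    _ ≤ (L ^ d : ℕ) + 1 := by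
        gcongr
        rw [mul_assoc, ENNReal.mul_inv_cancel (by simp [hM]) (by simp), mul_one]
    _ = _ := by push_cast; rfl

end UniformHypergraph

/-! ### Unbiased resampling with random selection weights -/

section Resampling

variable {β : Type*}

/-- The weighted total of `m` over a list of weighted items. -/
noncomputable def weightedTotal (m : β → ℕ) (l : List (β × ℝ≥0)) : ℝ≥0∞ :=
  (l.map fun p => (p.2 : ℝ≥0∞) * m p.1).sum

/-- The sum of the selection weights of a list of items `(b, w, x)`. -/
noncomputable def selectionTotal (r : List (β × ℝ≥0 × ℕ)) : ℝ≥0 :=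
  ∑ i : Fin r.length, r[i].2.1 * (r[i].2.2 + 1)

/-- The index of an item `(b, w, x)` drawn with probability proportional to `w * (x + 1)`. -/
noncomputable def selectIndex (r : List (β × ℝ≥0 × ℕ)) (hr : selectionTotal r ≠ 0) :
    PMF (Fin r.length) :=
  PMF.ofFintype (fun i => ((r[i].2.1 * (r[i].2.2 + 1) / selectionTotal r : ℝ≥0) : ℝ≥0∞)) <| by
    have : ∑ i : Fin r.length, r[i].2.1 * (r[i].2.2 + 1) / selectionTotal r = 1 := by
      rw [← Finset.sum_div]
      exact div_self hr
    exact_mod_cast congrArg (fun x : ℝ≥0 => (x : ℝ≥0∞)) this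

open Classical in
/-- `N` independent draws from a list of items `(b, w, x)`, reweighted so that weighted totals are
preserved in expectation. -/
noncomputable def selectItems (N : ℕ) (r : List (β × ℝ≥0 × ℕ)) : PMF (List (β × ℝ≥0)) :=
  if hr : selectionTotal r = 0 then PMF.pure []
  else PMF.sequence (List.replicate N ((selectIndex r hr).map fun i =>
    (r[i].1, selectionTotal r / (N * (r[i].2.2 + 1)))))

theorem expect_selectIndex (r : List (β × ℝ≥0 × ℕ)) (hr : selectionTotal r ≠ 0)
    (f : Fin r.length → ℝ≥0) :
    ((selectIndex r hr).expect fun i => (f i : ℝ≥0∞)) =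
      ((∑ i, r[i].2.1 * (r[i].2.2 + 1) / selectionTotal r * f i : ℝ≥0) : ℝ≥0∞) := by
  simp only [PMF.expect, selectIndex, PMF.ofFintype_apply, tsum_fintype]
  push_cast
  rfl

/-- The new weight is the old one divided by `N` times the selection probability, so the selection
probability cancels. If the selection total is zero, all weights vanish because `x + 1` is positive.
-/
theorem expect_selectItems (m : β → ℕ) (N : ℕ) (hN : N ≠ 0) (r : List (β × ℝ≥0 × ℕ)) :
    (selectItems N r).expect (weightedTotal m) =
      (r.map fun p => (p.2.1 : ℝ≥0∞) * m p.1).sum := by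
  rw [← Fin.sum_univ_fun_getElem]
  unfold selectItems
  split_ifs with hr
  · rw [PMF.expect_pure]
    rw [selectionTotal, Finset.sum_eq_zero_iff] at hr
    symm
    simp only [weightedTotal, List.map_nil, List.sum_nil, Finset.sum_eq_zero_iff]
    intro i hi
    have h1 := hr i hi
    have h2 : r[i].2.1 = 0 := by
      rcases mul_eq_zero.1 h1 with h | h
      · exact h
      · exact absurd h (by positivity)
    change (r[i].2.1 : ℝ≥0∞) * m r[i].1 = 0
    rw [h2, ENNReal.coe_zero, zero_mul]
  · set S := selectionTotal r with hS
    have hE : ((selectIndex r hr).map fun i => (r[i].1, S / (N * (r[i].2.2 + 1)))).expect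
        (fun p => (p.2 : ℝ≥0∞) * m p.1) = ((∑ i : Fin r.length, r[i].2.1 * m r[i].1 / N : ℝ≥0) :
          ℝ≥0∞) := by
      rw [PMF.expect_map]
      have := expect_selectIndex r hr fun i => S / (N * (r[i].2.2 + 1)) * m r[i].1
      push_cast at this ⊢
      rw [this, ← hS]
      refine Finset.sum_congr rfl fun i _ => ?_
      norm_cast
      push_cast
      field_simp
    unfold weightedTotal
    rw [PMF.expect_sequence_sum, List.map_replicate, List.sum_replicate, hE, nsmul_eq_mul]
    have : (N : ℝ≥0) * ∑ i : Fin r.length, r[i].2.1 * m r[i].1 / N =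
        ∑ i : Fin r.length, r[i].2.1 * m r[i].1 := by
      rw [Finset.mul_sum]
      refine Finset.sum_congr rfl fun i _ => ?_
      field_simp
    have := congrArg (fun x : ℝ≥0 => (x : ℝ≥0∞)) this
    push_cast at this ⊢
    exact this

/-- The draws are independent and identically distributed, so the excess over the squared mean is at
most `N` times the second moment of one draw. That moment equals `N⁻²` times the product of the two
sums on the right. -/
theorem expect_selectItems_sq_le (m : β → ℕ) (N : ℕ) (hN : N ≠ 0) (r : List (β × ℝ≥0 × ℕ)) :
    ((selectItems N r).expect fun l => weightedTotal m l ^ 2) ≤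
      (r.map fun p => (p.2.1 : ℝ≥0∞) * m p.1).sum ^ 2 +
      (N : ℝ≥0∞)⁻¹ * ((r.map fun p => ((p.2.1 * (p.2.2 + 1) : ℝ≥0) : ℝ≥0∞)).sum *
        (r.map fun p => ((p.2.1 * m p.1 ^ 2 / (p.2.2 + 1) : ℝ≥0) : ℝ≥0∞)).sum) := by
  have hmean := expect_selectItems m N hN r
  unfold selectItems at hmean ⊢
  split_ifs at hmean ⊢ with hr
  · rw [PMF.expect_pure] at hmean ⊢
    rw [hmean]
    exact le_self_add
  · set S := selectionTotal r with hS
    have hS' : (r.map fun p => ((p.2.1 * (p.2.2 + 1) : ℝ≥0) : ℝ≥0∞)).sum = S := by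
      rw [← Fin.sum_univ_fun_getElem, hS, selectionTotal]
      push_cast
      rfl
    unfold weightedTotal at hmean ⊢
    rw [PMF.expect_sequence_sum] at hmean
    refine (PMF.expect_sequence_sum_sq_le _ _).trans ?_
    rw [hmean, add_comm]
    gcongr
    rw [List.map_replicate, List.sum_replicate, nsmul_eq_mul, PMF.expect_map, hS',
      ← Fin.sum_univ_fun_getElem]
    have h1 := expect_selectIndex r hr fun i => (S / (N * (r[i].2.2 + 1)) * m r[i].1) ^ 2
    have h2 : (N : ℝ≥0) * ∑ i : Fin r.length, r[i].2.1 * (r[i].2.2 + 1) / S *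
        (S / (N * (r[i].2.2 + 1)) * m r[i].1) ^ 2 =
        (N : ℝ≥0)⁻¹ * (S * ∑ i : Fin r.length, r[i].2.1 * m r[i].1 ^ 2 / (r[i].2.2 + 1)) := by
      simp only [Finset.mul_sum]
      refine Finset.sum_congr rfl fun i _ => ?_
      field_simp
    rw [← hS] at h1
    have h3 := congrArg (fun x : ℝ≥0 => (x : ℝ≥0∞)) h2
    simp only [ENNReal.coe_mul, ENNReal.coe_natCast, ← h1] at h3
    rw [ENNReal.coe_inv (by exact_mod_cast hN)] at h3
    simp only [ENNReal.ofNNReal_finsetSum] at h3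
    refine le_of_eq (Eq.trans ?_ h3)
    simp

/-- Resampling of weighted items, with selection probabilities governed by random estimates `X b`
for the value of the item `b`. -/
noncomputable def resample (N : ℕ) (X : β → PMF ℕ) (c : List (β × ℝ≥0)) : PMF (List (β × ℝ≥0)) :=
  (PMF.sequence (c.map fun p => (X p.1).map fun x => (p.1, p.2, x))).bind (selectItems N)

theorem expect_resample (m : β → ℕ) (N : ℕ) (hN : N ≠ 0) (X : β → PMF ℕ) (c : List (β × ℝ≥0)) :
    (resample N X c).expect (weightedTotal m) = weightedTotal m c := by
  rw [resample, PMF.expect_bind]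
  simp only [expect_selectItems m N hN]
  rw [PMF.expect_sequence_sum, List.map_map, weightedTotal]
  congr 1
  refine List.map_congr_left fun p _ => ?_
  simp [PMF.expect_map, PMF.expect_const]

/-- The excess is a product of two sums, `∑ w (x + 1)` and `∑ w m² / (x + 1)`, with means at most
`K₁` and `K₂` times the weighted total. Different items have independent estimates. For one item the
factor `x + 1` cancels, leaving `(w m)²`, which `hK` bounds by `K₁ K₂ (w m)²`. -/
theorem expect_resample_sq_le (m : β → ℕ) (N : ℕ) (hN : N ≠ 0) (X : β → PMF ℕ)
    (K₁ K₂ : ℝ≥0∞) (hK : 1 ≤ K₁ * K₂) (c : List (β × ℝ≥0))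
    (h₁ : ∀ p ∈ c, ((X p.1).expect fun x => ((x + 1 : ℕ) : ℝ≥0∞)) ≤ K₁ * m p.1)
    (h₂ : ∀ p ∈ c, (m p.1 : ℝ≥0∞) * ((X p.1).expect fun x => ((x + 1 : ℕ) : ℝ≥0∞)⁻¹) ≤ K₂) :
    ((resample N X c).expect fun l => weightedTotal m l ^ 2) ≤
      (1 + K₁ * K₂ * (N : ℝ≥0∞)⁻¹) * weightedTotal m c ^ 2 := by
  rw [resample, PMF.expect_bind]
  refine (PMF.expect_mono _ fun r => expect_selectItems_sq_le m N hN r).trans ?_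
  rw [PMF.expect_add, PMF.expect_mul_left]
  have hA : ((PMF.sequence (c.map fun p => (X p.1).map fun x => (p.1, p.2, x))).expect
      fun r => (r.map fun p => (p.2.1 : ℝ≥0∞) * m p.1).sum ^ 2) ≤ weightedTotal m c ^ 2 := by
    simp only [sq]
    refine PMF.expect_sequence_sum_mul_sum_le c _ _ _ (fun p => (p.2 : ℝ≥0∞) * m p.1)
      (fun p => (p.2 : ℝ≥0∞) * m p.1) ?_ ?_ ?_ <;>
    · intro p _
      simp [PMF.expect_map, PMF.expect_const]
  have hB : ((PMF.sequence (c.map fun p => (X p.1).map fun x => (p.1, p.2, x))).expect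
      fun r => (r.map fun p => ((p.2.1 * (p.2.2 + 1) : ℝ≥0) : ℝ≥0∞)).sum *
        (r.map fun p => ((p.2.1 * m p.1 ^ 2 / (p.2.2 + 1) : ℝ≥0) : ℝ≥0∞)).sum) ≤
      (K₁ * weightedTotal m c) * (K₂ * weightedTotal m c) := by
    have hsum : ∀ K : ℝ≥0∞, K * weightedTotal m c =
        (c.map fun p => K * ((p.2 : ℝ≥0∞) * m p.1)).sum := by
      intro K
      rw [weightedTotal, List.sum_map_mul_left]
    rw [hsum, hsum]
    refine PMF.expect_sequence_sum_mul_sum_le c _ _ _ _ _ ?_ ?_ ?_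
    · intro p hp
      rw [PMF.expect_map]
      have h : ∀ x : ℕ, ((p.2 * (x + 1) : ℝ≥0) : ℝ≥0∞) = p.2 * ((x + 1 : ℕ) : ℝ≥0∞) := by
        intro x; push_cast; rfl
      simp only [h]
      rw [PMF.expect_mul_left]
      calc _ ≤ (p.2 : ℝ≥0∞) * (K₁ * m p.1) := by gcongr; exact h₁ p hp
        _ = _ := by ring
    · intro p hp
      rw [PMF.expect_map]
      have h : ∀ x : ℕ, ((p.2 * m p.1 ^ 2 / (x + 1) : ℝ≥0) : ℝ≥0∞) =
          p.2 * m p.1 * m p.1 * ((x + 1 : ℕ) : ℝ≥0∞)⁻¹ := by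
        intro x
        rw [ENNReal.coe_div (by positivity)]
        push_cast
        rw [div_eq_mul_inv]
        ring
      simp only [h]
      rw [PMF.expect_mul_left]
      calc _ = (p.2 : ℝ≥0∞) * m p.1 *
            (m p.1 * ((X p.1).expect fun x => ((x + 1 : ℕ) : ℝ≥0∞)⁻¹)) := by ring
        _ ≤ (p.2 : ℝ≥0∞) * m p.1 * K₂ := by gcongr; exact h₂ p hp
        _ = _ := by ring
    · intro p _
      rw [PMF.expect_map]
      have h : ∀ x : ℕ, ((p.2 * (x + 1) : ℝ≥0) : ℝ≥0∞) *
          ((p.2 * m p.1 ^ 2 / (x + 1) : ℝ≥0) : ℝ≥0∞) = (p.2 * m p.1) * (p.2 * m p.1) := by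
        intro x
        rw [← ENNReal.coe_mul]
        have : p.2 * ((x : ℝ≥0) + 1) * (p.2 * m p.1 ^ 2 / (x + 1)) =
            (p.2 * m p.1) * (p.2 * m p.1) := by field_simp
        rw [this]
        push_cast
        rfl
      simp only [h, PMF.expect_const]
      calc _ = 1 * ((p.2 * m p.1) * (p.2 * m p.1) : ℝ≥0∞) := (one_mul _).symm
        _ ≤ (K₁ * K₂) * ((p.2 * m p.1) * (p.2 * m p.1) : ℝ≥0∞) := by gcongr
        _ = _ := by ring
  calc _ ≤ weightedTotal m c ^ 2 +
        (N : ℝ≥0∞)⁻¹ * ((K₁ * weightedTotal m c) * (K₂ * weightedTotal m c)) := by gcongr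
    _ = _ := by ring

theorem implementable_selectItems {V : Type*} {d : ℕ} (N : ℕ) (r : List (β × ℝ≥0 × ℕ)) :
    Implementable (V := V) (d := d) 0 (fun l => l.length ≤ N) fun _ => selectItems N r := by
  unfold selectItems
  split_ifs with hr
  · exact Implementable.pure _ _ (Nat.zero_le _)
  · exact (Implementable.sequence_replicate (Implementable.const _ (fun _ => True)
      fun _ _ => trivial) N).mono (by simp) fun l hl => hl.le

theorem implementable_resample {V : Type*} {d : ℕ} (N q : ℕ)
    (X : β → UniformHypergraph V d → PMF ℕ)
    (hX : ∀ b, Implementable q (fun _ => True) (X b)) (c : List (β × ℝ≥0)) :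
    Implementable (c.length * q) (fun l => l.length ≤ N)
      fun H => resample N (fun b => X b H) c := by
  have h := Implementable.sequence (f := fun (p : β × ℝ≥0) H => (X p.1 H).map fun x => (p.1, p.2, x))
    (fun p => (hX p.1).map _ (post' := fun _ => True) fun _ _ => trivial) c
  exact (h.bind fun r _ => implementable_selectItems N r).mono (by simp) fun _ h => h

end Resampling

/-! ### Boxes, rounds and the estimator -/

/-- Pairwise disjoint vertex sets in each of which all vertices agree in the first `t` bits of their
codes. -/
def Box {V : Type*} (d : ℕ) (code : V → ℕ) (t : ℕ) : Type _ :=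
  {A : Fin d → Finset V // (Pairwise fun i j => Disjoint (A i) (A j)) ∧
    ∀ i, ∀ x ∈ A i, ∀ y ∈ A i, ∀ s < t, (code x).testBit s = (code y).testBit s}

namespace Box

variable {V : Type*} {d : ℕ} {code : V → ℕ} {t : ℕ}

/-- The part of a box in which bit `t` of the vertices in the `i`-th set is `σ i`. -/
def child (b : Box d code t) (σ : Fin d → Bool) : Box d code (t + 1) :=
  ⟨fun i => (b.1 i).filter fun x => (code x).testBit t = σ i,
    fun i j hij => (b.2.1 hij).mono (Finset.filter_subset _ _) (Finset.filter_subset _ _), by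
      intro i x hx y hy s hs
      obtain ⟨hx, hx'⟩ := Finset.mem_filter.1 hx
      obtain ⟨hy, hy'⟩ := Finset.mem_filter.1 hy
      rcases Nat.lt_succ_iff_lt_or_eq.1 hs with h | rfl
      · exact b.2.2 i x hx y hy s h
      · rw [hx', hy']⟩

/-- The box of colour classes of a colouring. -/
def ofColoring [Fintype V] (χ : V → Fin d) : Box d code 0 :=
  ⟨fun i => Finset.univ.filter fun x => χ x = i, by
    intro i j hij
    refine Finset.disjoint_left.2 fun x hx hy => hij ?_
    rw [← (Finset.mem_filter.1 hx).2, ← (Finset.mem_filter.1 hy).2],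
    fun i x _ y _ s hs => absurd hs (Nat.not_lt_zero s)⟩

/-- All children of all boxes in a weighted list. -/
noncomputable def splitAll (l : List (Box d code t × ℝ≥0)) : List (Box d code (t + 1) × ℝ≥0) :=
  l.flatMap fun p => (Finset.univ : Finset (Fin d → Bool)).toList.map fun σ => (p.1.child σ, p.2)

theorem length_splitAll (l : List (Box d code t × ℝ≥0)) :
    (splitAll l).length = l.length * 2 ^ d := by
  simp [splitAll, List.length_flatMap]

/-- The items of a list whose box spans a hyperedge. -/
noncomputable def nonemptyItems (H : UniformHypergraph V d) (l : List (Box d code t × ℝ≥0)) :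
    List (Box d code t × ℝ≥0) :=
  l.filter fun p => H.gpis p.1.1

theorem implementable_nonemptyItems (l : List (Box d code t × ℝ≥0)) :
    Implementable l.length (fun r => r.length ≤ l.length)
      fun H => PMF.pure (nonemptyItems H l) := by
  induction l with
  | nil => exact Implementable.pure _ _ le_rfl
  | cons p l ih =>
    have h := (Implementable.gpis p.1.1 p.1.2.1).bind fun b _ =>
      ih.map (fun r => if b then p :: r else r)
        (post' := fun r => r.length ≤ (p :: l).length) (by
          intro r hr
          split_ifs
          · simpa using hr
          · exact hr.trans (by simp))
    refine Eq.mp ?_ (h.mono (q' := (p :: l).length) (by simp [add_comm]) fun _ h => h)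
    congr 1
    ext1 H
    rw [PMF.pure_bind, PMF.pure_map]
    simp only [nonemptyItems, List.filter_cons]

variable [DecidableEq V]

/-- Every tuple lies in exactly one child, the one indexed by the `t`-th bits of its entries. -/
theorem sum_card_tuples_child (H : UniformHypergraph V d) (b : Box d code t) :
    ∑ σ, (H.tuples (b.child σ).1).card = (H.tuples b.1).card := by
  have h : (H.tuples b.1).card = ∑ σ : Fin d → Bool, ((H.tuples b.1).filter
      fun v => (fun i => (code (v i)).testBit t) = σ).card :=
    Finset.card_eq_sum_card_fiberwise fun _ _ => Finset.mem_coe.2 (Finset.mem_univ _)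
  rw [h]
  refine Finset.sum_congr rfl fun σ _ => congrArg Finset.card ?_
  ext v
  simp only [Finset.mem_filter, UniformHypergraph.mem_tuples, child, forall_and, funext_iff]
  tauto

/-- The number of tuples of a box that form a hyperedge. -/
def value (H : UniformHypergraph V d) (b : Box d code t) : ℕ := (H.tuples b.1).card

theorem weightedTotal_splitAll (H : UniformHypergraph V d) (l : List (Box d code t × ℝ≥0)) :
    weightedTotal (value H) (splitAll l) = weightedTotal (value H) l := by
  induction l with
  | nil => rfl
  | cons p l ih =>
    have h : splitAll (p :: l) = ((Finset.univ : Finset (Fin d → Bool)).toList.map fun σ =>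
        (p.1.child σ, p.2)) ++ splitAll l := by simp [splitAll]
    unfold weightedTotal at ih ⊢
    rw [h, List.map_append, List.sum_append, ih, List.map_cons, List.sum_cons, List.map_map,
      Finset.sum_map_toList]
    congr 1
    simp only [Function.comp_apply, ← Finset.mul_sum]
    congr 1
    exact_mod_cast sum_card_tuples_child H p.1

theorem gpis_iff_value_pos (H : UniformHypergraph V d) (b : Box d code t) :
    H.gpis b.1 = true ↔ 0 < value H b := by
  rw [H.gpis_eq_true_iff _ b.2.1, value, Finset.card_pos]

theorem weightedTotal_nonemptyItems (H : UniformHypergraph V d) (l : List (Box d code t × ℝ≥0)) :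
    weightedTotal (value H) (nonemptyItems H l) = weightedTotal (value H) l := by
  induction l with
  | nil => rfl
  | cons p l ih =>
    unfold weightedTotal nonemptyItems at ih ⊢
    rw [List.filter_cons]
    split_ifs with h
    · rw [List.map_cons, List.sum_cons, ih, List.map_cons, List.sum_cons]
    · rw [ih, List.map_cons, List.sum_cons]
      rw [gpis_iff_value_pos, Nat.pos_iff_ne_zero, not_not] at h
      simp [h]

/-- Vertices that agree in all relevant bits have equal codes, so every set of the box has at most
one vertex. -/
theorem value_le_one (hcode : Function.Injective code) (ht : ∀ x, code x < 2 ^ t)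
    (H : UniformHypergraph V d) (b : Box d code t) : value H b ≤ 1 := by
  rw [value, Finset.card_le_one]
  intro v hv v' hv'
  rw [UniformHypergraph.mem_tuples] at hv hv'
  ext i
  refine hcode (Nat.eq_of_testBit_eq fun s => ?_)
  by_cases hs : s < t
  · exact b.2.2 i _ (hv.1 i) _ (hv'.1 i) s hs
  · have h : ∀ x, (code x).testBit s = false := fun x =>
      Nat.testBit_lt_two_pow ((ht x).trans_le (Nat.pow_le_pow_right (by norm_num) (by omega)))
    rw [h, h]

/-- The total weight of a list of items. -/
noncomputable def totalWeight (l : List (Box d code t × ℝ≥0)) : ℝ≥0 := (l.map Prod.snd).sum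

theorem totalWeight_nonemptyItems (hcode : Function.Injective code) (ht : ∀ x, code x < 2 ^ t)
    (H : UniformHypergraph V d) (l : List (Box d code t × ℝ≥0)) :
    ((totalWeight (nonemptyItems H l) : ℝ≥0) : ℝ≥0∞) = weightedTotal (value H) l := by
  rw [← weightedTotal_nonemptyItems]
  unfold totalWeight weightedTotal
  have h : ∀ p ∈ nonemptyItems H l, value H p.1 = 1 := fun p hp =>
    le_antisymm (value_le_one hcode ht H p.1)
      ((gpis_iff_value_pos H p.1).1 (List.mem_filter.1 hp).2)
  generalize nonemptyItems H l = r at h ⊢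
  induction r with
  | nil => simp
  | cons p r ih =>
    rw [List.forall_mem_cons] at h
    simp [← ih h.2, h.1]

variable [Fintype V]

/-- One round: split all boxes, drop the empty ones, and resample. -/
noncomputable def round (N R L : ℕ) (H : UniformHypergraph V d) (l : List (Box d code t × ℝ≥0)) :
    PMF (List (Box d code (t + 1) × ℝ≥0)) :=
  resample N (fun b => H.crudeEstimate R L b.1) (nonemptyItems H (splitAll l))

theorem expect_round (N R L : ℕ) (hN : N ≠ 0) (H : UniformHypergraph V d)
    (l : List (Box d code t × ℝ≥0)) :
    (round N R L H l).expect (weightedTotal (value H)) = weightedTotal (value H) l := by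
  rw [round, expect_resample _ _ hN, weightedTotal_nonemptyItems, weightedTotal_splitAll]

theorem expect_round_sq_le (N R L : ℕ) (hN : N ≠ 0) (hL : Fintype.card V < 2 ^ L)
    (hR : (1 - 2⁻¹ ^ d : ℝ≥0∞) ^ R * (Fintype.card V : ℝ≥0∞) ^ d ≤ 1)
    (H : UniformHypergraph V d) (l : List (Box d code t × ℝ≥0)) :
    ((round N R L H l).expect fun l => weightedTotal (value H) l ^ 2) ≤
      (1 + ((R * L ^ d + 1 : ℕ) : ℝ≥0∞) * ((L ^ d + 1 : ℕ) : ℝ≥0∞) * (N : ℝ≥0∞)⁻¹) *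
        weightedTotal (value H) l ^ 2 := by
  rw [round, ← weightedTotal_splitAll, ← weightedTotal_nonemptyItems]
  refine expect_resample_sq_le _ N hN _ _ _ ?_ _ (fun p hp => ?_) fun p _ => ?_
  · exact_mod_cast Nat.one_le_iff_ne_zero.2 (by positivity)
  -- Empty boxes were dropped, so the `+ 1` in the selection weight is absorbed by a value of at
  -- least `1`.
  · have hv : 1 ≤ value H p.1 :=
      (gpis_iff_value_pos H p.1).1 (List.mem_filter.1 hp).2
    push_cast
    rw [PMF.expect_add, PMF.expect_const, add_mul, one_mul]
    gcongr
    · exact_mod_cast H.expect_crudeEstimate_le R L p.1.1 p.1.2.1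
    · exact_mod_cast hv
  · exact H.expect_inv_crudeEstimate_le R L hL hR _ p.1.2.1

theorem implementable_round (N R L : ℕ) (l : List (Box d code t × ℝ≥0)) (hl : l.length ≤ N) :
    Implementable (N * 2 ^ d * (R * L ^ d + 1)) (fun l => l.length ≤ N)
      fun H => round N R L H l := by
  have h := (implementable_nonemptyItems (splitAll l)).bind fun c hc =>
    (implementable_resample N (R * L ^ d) (fun (b : Box d code (t + 1)) H =>
      H.crudeEstimate R L b.1)
      (fun b => UniformHypergraph.implementable_crudeEstimate R L b.1 b.2.1) c).mono
        (Nat.mul_le_mul_right _ hc) fun _ h => h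
  simp only [PMF.pure_bind] at h
  refine h.mono ?_ fun _ h => h
  rw [length_splitAll, mul_add, mul_one, add_comm]
  gcongr

/-- The initial population: `N` random colourings. -/
noncomputable def initial (V : Type*) [Fintype V] [DecidableEq V] (d : ℕ) [NeZero d] (code : V → ℕ) (N : ℕ) :
    PMF (List (Box d code 0 × ℝ≥0)) :=
  PMF.sequence (List.replicate N ((PMF.uniformOfFintype (V → Fin d)).map fun χ =>
    (ofColoring χ, (d : ℝ≥0) ^ d / (d.factorial * N))))

/-- A hyperedge tuple has distinct entries, so it receives its prescribed colours with probability
`d ^ (-d)`. The initial weight `d ^ d / (d! N)` cancels this and the `d!` orderings. -/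
theorem expect_value_ofColoring [NeZero d] (H : UniformHypergraph V d) :
    ((PMF.uniformOfFintype (V → Fin d)).expect fun χ =>
      (value H (ofColoring χ : Box d code 0) : ℝ≥0∞)) =
      (d.factorial * H.numEdges : ℕ) * (d : ℝ≥0∞)⁻¹ ^ d := by
  have h1 : ∀ χ : V → Fin d, (value H (ofColoring χ : Box d code 0) : ℝ≥0∞) =
      ∑ v ∈ H.tuples (fun _ => Finset.univ), if ∀ i, χ (v i) = i then 1 else 0 := by
    intro χ
    rw [Finset.sum_boole, value]
    congr 2
    ext v
    simp [UniformHypergraph.mem_tuples, ofColoring, and_comm]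
  simp only [h1]
  rw [PMF.expect_finset_sum, ← H.card_tuples_univ, ← nsmul_eq_mul]
  refine Finset.sum_eq_card_nsmul fun v hv => ?_
  have hc := H.card_eq _ (UniformHypergraph.mem_tuples.1 hv).2
  have hinj : Function.Injective v := by
    have : (Finset.univ.image v).card = (Finset.univ : Finset (Fin d)).card := by
      rw [hc]; simp
    simpa using Finset.card_image_iff.1 this
  have h2 := PMF.expect_uniform_pi (Finset.univ.image v)
    fun x => Finset.univ.filter fun i => v i = x
  have h3 : ∀ χ : V → Fin d, (∀ x ∈ Finset.univ.image v,
      χ x ∈ Finset.univ.filter fun i => v i = x) ↔ ∀ i, χ (v i) = i := by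
    intro χ
    simp [hinj.eq_iff]
  simp only [h3] at h2
  rw [h2, Finset.prod_image fun i _ j _ h => hinj h]
  simp [hinj.eq_iff, Finset.filter_eq']

theorem expect_initial_single [NeZero d] (N : ℕ) (hN : N ≠ 0) (H : UniformHypergraph V d) :
    (((PMF.uniformOfFintype (V → Fin d)).map fun χ =>
      ((ofColoring χ : Box d code 0), (d : ℝ≥0) ^ d / (d.factorial * N))).expect
        fun p => (p.2 : ℝ≥0∞) * value H p.1) = (N : ℝ≥0∞)⁻¹ * H.numEdges := by
  rw [PMF.expect_map]
  dsimp only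
  rw [PMF.expect_mul_left, expect_value_ofColoring]
  have hd : (d : ℝ≥0) ≠ 0 := by exact_mod_cast NeZero.ne d
  have hf : (d.factorial : ℝ≥0) ≠ 0 := by exact_mod_cast d.factorial_ne_zero
  have : (d : ℝ≥0) ^ d / (d.factorial * N) * ((d.factorial * H.numEdges : ℕ) * (d : ℝ≥0)⁻¹ ^ d) =
      (N : ℝ≥0)⁻¹ * H.numEdges := by
    push_cast
    rw [inv_pow]
    field_simp
  have h := congrArg (fun x : ℝ≥0 => (x : ℝ≥0∞)) this
  simp only [ENNReal.coe_mul, ENNReal.coe_natCast, ENNReal.coe_pow, ENNReal.coe_inv hd] at h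
  rw [ENNReal.coe_inv (by exact_mod_cast hN)] at h
  exact h

theorem expect_initial [NeZero d] (N : ℕ) (hN : N ≠ 0) (H : UniformHypergraph V d) :
    (initial V d code N).expect (weightedTotal (value H)) = H.numEdges := by
  unfold initial weightedTotal
  rw [PMF.expect_sequence_sum, List.map_replicate, List.sum_replicate,
    expect_initial_single N hN, nsmul_eq_mul, ← mul_assoc,
    ENNReal.mul_inv_cancel (by exact_mod_cast hN) (by simp), one_mul]

/-- No colouring contributes more than `d ^ d m(H) / N`, and the second moment of one term is at
most this maximum times its mean. -/
theorem expect_initial_sq_le [NeZero d] (N : ℕ) (hN : N ≠ 0) (H : UniformHypergraph V d) :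
    ((initial V d code N).expect fun l => weightedTotal (value H) l ^ 2) ≤
      (1 + ((d ^ d : ℕ) : ℝ≥0∞) * (N : ℝ≥0∞)⁻¹) * (H.numEdges : ℝ≥0∞) ^ 2 := by
  have h1 := expect_initial (code := code) N hN H
  unfold initial weightedTotal at h1 ⊢
  refine (PMF.expect_sequence_sum_sq_le _ _).trans ?_
  rw [PMF.expect_sequence_sum] at h1
  rw [h1, List.map_replicate, List.sum_replicate, nsmul_eq_mul, add_mul, one_mul, add_comm]
  refine add_le_add le_rfl ?_
  have h2 : ∀ χ : V → Fin d, ((((d : ℝ≥0) ^ d / (d.factorial * N) : ℝ≥0) : ℝ≥0∞) *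
      value H (ofColoring χ : Box d code 0)) ≤ (N : ℝ≥0∞)⁻¹ * ((d ^ d : ℕ) * H.numEdges) := by
    intro χ
    have hle : value H (ofColoring χ : Box d code 0) ≤ d.factorial * H.numEdges := by
      rw [← H.card_tuples_univ]
      refine Finset.card_le_card fun v hv => ?_
      rw [UniformHypergraph.mem_tuples] at hv ⊢
      exact ⟨fun _ => Finset.mem_univ _, hv.2⟩
    have hf : (d.factorial : ℝ≥0) ≠ 0 := by exact_mod_cast d.factorial_ne_zero
    have h : (d : ℝ≥0) ^ d / (d.factorial * N) * (d.factorial * H.numEdges : ℕ) =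
        (N : ℝ≥0)⁻¹ * ((d ^ d : ℕ) * H.numEdges) := by
      push_cast
      field_simp
    have h := congrArg (fun x : ℝ≥0 => (x : ℝ≥0∞)) h
    simp only [ENNReal.coe_mul, ENNReal.coe_natCast] at h
    rw [ENNReal.coe_inv (by exact_mod_cast hN)] at h
    refine le_trans ?_ h.le
    gcongr
  calc _ ≤ (N : ℝ≥0∞) * (((PMF.uniformOfFintype (V → Fin d)).map fun χ =>
      ((ofColoring χ : Box d code 0), (d : ℝ≥0) ^ d / (d.factorial * N))).expect
        fun p => (N : ℝ≥0∞)⁻¹ * ((d ^ d : ℕ) * H.numEdges) * ((p.2 : ℝ≥0∞) * value H p.1)) := by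
        rw [PMF.expect_map, PMF.expect_map]
        refine mul_le_mul_right ?_ _
        refine PMF.expect_mono _ fun χ => ?_
        rw [sq]
        exact mul_le_mul_left (h2 χ) _
    _ = (N * (N : ℝ≥0∞)⁻¹) * (((d ^ d : ℕ) : ℝ≥0∞) * (N : ℝ≥0∞)⁻¹ * (H.numEdges : ℝ≥0∞) ^ 2) := by
        rw [PMF.expect_mul_left, expect_initial_single N hN]
        ring
    _ = _ := by
        rw [ENNReal.mul_inv_cancel (by exact_mod_cast hN) (by simp), one_mul]

/-- The population after `t` rounds. -/
noncomputable def population [NeZero d] (code : V → ℕ) (N R L : ℕ) (H : UniformHypergraph V d) :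
    (t : ℕ) → PMF (List (Box d code t × ℝ≥0))
  | 0 => initial V d code N
  | t + 1 => (population code N R L H t).bind (round N R L H)

theorem expect_population [NeZero d] (N R L : ℕ) (hN : N ≠ 0) (H : UniformHypergraph V d) (t : ℕ) :
    (population code N R L H t).expect (weightedTotal (value H)) = H.numEdges := by
  induction t with
  | zero => exact expect_initial N hN H
  | succ t ih =>
    rw [population, PMF.expect_bind]
    simp only [expect_round N R L hN]
    exact ih

theorem expect_population_sq_le [NeZero d] (N R L : ℕ) (hN : N ≠ 0)
    (hL : Fintype.card V < 2 ^ L)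
    (hR : (1 - 2⁻¹ ^ d : ℝ≥0∞) ^ R * (Fintype.card V : ℝ≥0∞) ^ d ≤ 1)
    (H : UniformHypergraph V d) (t : ℕ) :
    ((population code N R L H t).expect fun l => weightedTotal (value H) l ^ 2) ≤
      (1 + ((R * L ^ d + 1 : ℕ) : ℝ≥0∞) * ((L ^ d + 1 : ℕ) : ℝ≥0∞) * (N : ℝ≥0∞)⁻¹) ^ t *
        ((1 + ((d ^ d : ℕ) : ℝ≥0∞) * (N : ℝ≥0∞)⁻¹) * (H.numEdges : ℝ≥0∞) ^ 2) := by
  induction t with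
  | zero => simpa [population] using expect_initial_sq_le (code := code) N hN H
  | succ t ih =>
    rw [population, PMF.expect_bind]
    refine (PMF.expect_mono _ fun l => expect_round_sq_le N R L hN hL hR H l).trans ?_
    rw [PMF.expect_mul_left, pow_succ']
    refine (mul_le_mul_right ih _).trans (le_of_eq ?_)
    ring

theorem implementable_population [NeZero d] (code : V → ℕ) (N R L : ℕ) (t : ℕ) :
    Implementable (t * (N * 2 ^ d * (R * L ^ d + 1)))
      (fun l : List (Box d code t × ℝ≥0) => l.length ≤ N)
      fun H => population code N R L H t := by
  induction t with
  | zero =>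
    exact (Implementable.sequence_replicate (Implementable.const _ (fun _ => True)
      fun _ _ => trivial) N).mono (by simp) fun l hl => hl.le
  | succ t ih =>
    exact (ih.bind fun l hl => implementable_round N R L l hl).mono (by rw [add_mul, one_mul])
      fun _ h => h

/-- The estimate for the number of hyperedges after `t` rounds. -/
noncomputable def estimate [NeZero d] (code : V → ℕ) (N R L t : ℕ) (H : UniformHypergraph V d) :
    PMF ℝ≥0 :=
  ((population code N R L H t).bind fun l => PMF.pure (nonemptyItems H l)).map totalWeight

theorem implementable_estimate [NeZero d] (code : V → ℕ) (N R L t : ℕ) :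
    Implementable (t * (N * 2 ^ d * (R * L ^ d + 1)) + N) (fun _ => True)
      fun H : UniformHypergraph V d => estimate code N R L t H :=
  (((implementable_population code N R L t).bind fun l hl =>
    (implementable_nonemptyItems l).mono hl fun _ h => h.trans hl).map totalWeight)
      fun _ _ => trivial

theorem expect_estimate [NeZero d] (hcode : Function.Injective code) (N R L t : ℕ)
    (ht : ∀ x, code x < 2 ^ t) (H : UniformHypergraph V d) (f : ℝ≥0∞ → ℝ≥0∞) :
    ((estimate code N R L t H).expect fun z => f z) =
      (population code N R L H t).expect fun l => f (weightedTotal (value H) l) := by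
  rw [estimate, PMF.expect_map, PMF.expect_bind]
  simp only [PMF.expect_pure, totalWeight_nonemptyItems hcode ht]

end Box

/-! ### Choice of parameters and conclusion -/

theorem PMF.toReal_toOuterMeasure_eq {α : Type*} (p : PMF α) (q : α → Prop) [DecidablePred q] :
    (p.toOuterMeasure {a | q a}).toReal = 1 - (p.expect fun a => if q a then 0 else 1).toReal := by
  have h1 : p.toOuterMeasure {a | q a} = p.expect fun a => if q a then 1 else 0 := by
    rw [PMF.toOuterMeasure_apply, PMF.expect]
    congr 1; ext a
    by_cases h : q a <;> simp [h]
  have h2 := p.expect_indicator_add_not q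
  have hA : (p.expect fun a => if q a then 1 else 0) ≠ ⊤ :=
    ne_top_of_le_ne_top ENNReal.one_ne_top (le_self_add.trans_eq h2)
  have hB : (p.expect fun a => if q a then 0 else 1) ≠ ⊤ :=
    ne_top_of_le_ne_top ENNReal.one_ne_top (le_add_self.trans_eq h2)
  have h3 := congrArg ENNReal.toReal h2
  rw [ENNReal.toReal_add hA hB, ENNReal.toReal_one] at h3
  rw [h1]
  linarith

/-- The power is at most `exp y ≤ 1 / (1 - y) ≤ 1 + 2 y`, the last step because `y ≤ 1 / 2`. -/
theorem one_add_pow_le_of_mul_le (x y : ℝ) (k : ℕ) (hx : 0 ≤ x) (hy : y ≤ 1 / 2)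
    (hxy : k * x ≤ y) : (1 + x) ^ k ≤ 1 + 2 * y := by
  have hy0 : 0 ≤ y := le_trans (by positivity) hxy
  have h1 : (1 + x) ^ k ≤ Real.exp y := by
    calc (1 + x) ^ k ≤ (Real.exp x) ^ k := by
          gcongr
          linarith [Real.add_one_le_exp x]
      _ = Real.exp (k * x) := (Real.exp_nat_mul x k).symm
      _ ≤ _ := Real.exp_le_exp.2 hxy
  have h2 : Real.exp y * Real.exp (-y) = 1 := by rw [← Real.exp_add]; simp
  have h3 := Real.add_one_le_exp (-y)
  have h4 := Real.exp_pos y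
  nlinarith

theorem one_sub_pow_mul_le_one (d n R : ℕ) (hn : 1 ≤ n)
    (hR : (2 : ℝ) ^ d * (d * Real.log n) ≤ R) :
    (1 - 2⁻¹ ^ d : ℝ≥0∞) ^ R * (n : ℝ≥0∞) ^ d ≤ 1 := by
  have hp : (2⁻¹ : ℝ≥0∞) ^ d ≤ 1 := pow_le_one₀ zero_le (by simp)
  rw [← ENNReal.toReal_le_toReal (by finiteness) (by finiteness)]
  rw [ENNReal.toReal_mul, ENNReal.toReal_pow, ENNReal.toReal_pow,
    ENNReal.toReal_sub_of_le hp (by simp), ENNReal.toReal_pow]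
  simp only [ENNReal.toReal_one, ENNReal.toReal_inv, ENNReal.toReal_ofNat, ENNReal.toReal_natCast]
  have hn' : (0 : ℝ) < n := by exact_mod_cast hn
  set p : ℝ := 2⁻¹ ^ d with hpd
  have hp0 : 0 < p := by positivity
  have hp1 : p ≤ 1 := pow_le_one₀ (by norm_num) (by norm_num)
  have hp2 : p * 2 ^ d = 1 := by rw [hpd, ← mul_pow]; norm_num
  calc (1 - p) ^ R * (n : ℝ) ^ d ≤ (Real.exp (-p)) ^ R * (n : ℝ) ^ d := by
        have := Real.add_one_le_exp (-p)
        gcongr; linarith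
    _ = Real.exp (-(p * R) + d * Real.log n) := by
        rw [Real.exp_add, ← Real.exp_nat_mul, Real.exp_nat_mul (Real.log n), Real.exp_log hn']
        congr 2
        ring
    _ ≤ 1 := by
        rw [Real.exp_le_one_iff]
        have : p * (2 ^ d * (d * Real.log n)) ≤ p * R := by gcongr
        rw [← mul_assoc, hp2, one_mul] at this
        linarith

theorem Box.expect_estimate_bad_le {V : Type*} [Fintype V] [DecidableEq V] {d : ℕ} [NeZero d]
    {code : V → ℕ} (hcode : Function.Injective code) (N R L : ℕ) (hN : N ≠ 0)
    (hlt : ∀ x, code x < 2 ^ L) (hL : Fintype.card V < 2 ^ L)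
    (hR : (1 - 2⁻¹ ^ d : ℝ≥0∞) ^ R * (Fintype.card V : ℝ≥0∞) ^ d ≤ 1)
    (ε : ℝ) (hε : 0 < ε) (hε1 : ε < 1)
    (hNε : 32 * ((L + 1) * ((R * L ^ d + 1) * (L ^ d + 1) * d ^ d)) / ε ^ 2 ≤ (N : ℝ))
    (H : UniformHypergraph V d) (bad : ℝ≥0 → Prop) [DecidablePred bad]
    (hbad : ∀ z, bad z → ε * H.numEdges < |(z : ℝ) - H.numEdges|) :
    ((estimate code N R L L H).expect fun z => if bad z then 1 else 0) ≤ 16⁻¹ := by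
  refine PMF.chebyshev _ (H.numEdges : ℝ≥0) ⟨ε, hε.le⟩ (by exact_mod_cast hε) ?_ ?_ bad
    (fun z hz => by rw [NNReal.coe_natCast]; exact hbad z hz)
  · rw [expect_estimate hcode N R L L hlt H (fun x => x), expect_population N R L hN]
    simp
  · rw [expect_estimate hcode N R L L hlt H (fun x => x ^ 2)]
    refine (expect_population_sq_le N R L hN hL hR H L).trans ?_
    rw [← mul_assoc, ENNReal.coe_natCast]
    refine mul_le_mul_left ?_ _
    -- One constant dominates both the loss `K₁ K₂` of a round and the loss `d ^ d` of the initial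
    -- colourings, so the second moment grows by at most `(1 + κ / N) ^ (L + 1)`.
    set κ : ℕ := (R * L ^ d + 1) * (L ^ d + 1) * d ^ d with hκ
    have hdd : 1 ≤ d ^ d := Nat.one_le_iff_ne_zero.2 (pow_ne_zero _ (NeZero.ne d))
    have h1 : (R * L ^ d + 1) * (L ^ d + 1) ≤ κ := Nat.le_mul_of_pos_right _ hdd
    have h2 : d ^ d ≤ κ := Nat.le_mul_of_pos_left _ (by positivity)
    calc _ ≤ (1 + (κ : ℝ≥0∞) * (N : ℝ≥0∞)⁻¹) ^ L * (1 + (κ : ℝ≥0∞) * (N : ℝ≥0∞)⁻¹) := by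
          gcongr
          exact_mod_cast h1
      _ = (((1 + κ * (N : ℝ≥0)⁻¹) ^ (L + 1) : ℝ≥0) : ℝ≥0∞) := by
          rw [pow_succ]
          push_cast
          rw [ENNReal.coe_inv (by exact_mod_cast hN)]
          simp
      _ ≤ _ := by
          rw [ENNReal.coe_le_coe, ← NNReal.coe_le_coe]
          push_cast
          have hN0 : (0 : ℝ) < N := by exact_mod_cast Nat.pos_of_ne_zero hN
          -- The constant `32` in `hNε` gives `(L + 1) κ / N ≤ ε² / 32`, hence the `ε² / 16`
          -- required by `PMF.chebyshev`.
          have h3 : (1 + (κ : ℝ) * (N : ℝ)⁻¹) ^ (L + 1) ≤ 1 + 2 * (ε ^ 2 / 32) := by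
            refine one_add_pow_le_of_mul_le _ _ _ (by positivity) (by nlinarith) ?_
            rw [div_le_iff₀ (by positivity)] at hNε
            rw [← div_eq_mul_inv, ← mul_div_assoc, div_le_iff₀ hN0, hκ]
            push_cast
            linarith
          refine h3.trans (le_of_eq ?_)
          change _ = 1 + ε ^ 2 / 16
          ring

theorem query_bound (d : ℕ) (c : ℝ) (hc : 0 < c) : ∃ C : ℝ, 0 < C ∧
    ∀ (y ε : ℝ) (L R N k : ℕ), 1 ≤ y → 0 < ε → ε < 1 → (L : ℝ) ≤ 2 * y →
      (R : ℝ) ≤ (2 ^ d * d + 1) * y → (k : ℝ) ≤ (c + 1) * y →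
      (N : ℝ) ≤ 32 * ((L + 1) * ((R * L ^ d + 1) * (L ^ d + 1) * d ^ d)) / ε ^ 2 + 1 →
      ((k * (L * (N * 2 ^ d * (R * L ^ d + 1)) + N) : ℕ) : ℝ) ≤ C * y ^ (5 * d + 5) / ε ^ 4 := by
  set a : ℝ := (2 ^ d * d + 1) * 2 ^ d + 1 with ha
  set b : ℝ := 32 * (3 * (a * (2 ^ d + 1) * d ^ d)) + 1 with hb
  have ha0 : 0 < a := by positivity
  have hb0 : 0 < b := by positivity
  refine ⟨(c + 1) * (2 * (b * 2 ^ d * a) + b), by positivity, ?_⟩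
  intro y ε L R N k hy hε hε1 hL hR hk hN
  have hy0 : 0 < y := by linarith
  have hyp : ∀ p : ℕ, 1 ≤ y ^ p := fun p => one_le_pow₀ hy
  have hLd : (L : ℝ) ^ d ≤ 2 ^ d * y ^ d := by
    rw [← mul_pow]; gcongr
  have hLd1 : (L : ℝ) ^ d + 1 ≤ (2 ^ d + 1) * y ^ d := by
    rw [add_mul, one_mul]; linarith [hyp d]
  have hRL : (R : ℝ) * L ^ d + 1 ≤ a * y ^ (d + 1) := by
    calc (R : ℝ) * L ^ d + 1 ≤ ((2 ^ d * d + 1) * y) * (2 ^ d * y ^ d) + y ^ (d + 1) := by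
          gcongr
          exact hyp _
      _ = _ := by rw [ha]; ring
  have hL1 : (L : ℝ) + 1 ≤ 3 * y := by linarith
  have hε2 : ε ^ 2 ≤ 1 := pow_le_one₀ hε.le hε1.le
  have hN' : (N : ℝ) ≤ b * y ^ (2 * d + 2) / ε ^ 2 := by
    calc (N : ℝ) ≤ 32 * ((3 * y) * ((a * y ^ (d + 1)) * ((2 ^ d + 1) * y ^ d) * d ^ d)) / ε ^ 2 +
          y ^ (2 * d + 2) / ε ^ 2 := by
          refine hN.trans ?_
          gcongr
          rw [le_div_iff₀ (by positivity), one_mul]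
          exact hε2.trans (hyp _)
      _ = _ := by rw [hb]; ring
  push_cast
  calc (k : ℝ) * (L * (N * 2 ^ d * (R * L ^ d + 1)) + N)
      ≤ ((c + 1) * y) * ((2 * y) * ((b * y ^ (2 * d + 2) / ε ^ 2) * 2 ^ d * (a * y ^ (d + 1))) +
        b * y ^ (2 * d + 2) / ε ^ 2 * y ^ (d + 2)) := by
        gcongr
        calc (N : ℝ) ≤ b * y ^ (2 * d + 2) / ε ^ 2 := hN'
          _ ≤ _ := le_mul_of_one_le_right (by positivity) (hyp _)
    -- The count is in fact of order `y ^ (3 * d + 5) / ε ^ 2`; the stated bound follows from `y ≥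
    -- 1` and `ε < 1`.
    _ = (c + 1) * (2 * (b * 2 ^ d * a) + b) * y ^ (3 * d + 5) / ε ^ 2 := by ring
    _ ≤ _ := by
        gcongr ?_ * ?_ / ?_
        · exact pow_le_pow_right₀ hy (by omega)
        · exact pow_le_pow_of_le_one hε.le hε1.le (by norm_num)

theorem exists_algorithm {V : Type*} [Fintype V] {d : ℕ} {q k : ℕ}
    (f : UniformHypergraph V d → PMF ℝ≥0) (hf : Implementable q (fun _ => True) f)
    (ε : ℝ) (hbad : ∀ (H : UniformHypergraph V d) (bad : ℝ≥0 → Prop) [DecidablePred bad],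
      (∀ z, bad z → ε * H.numEdges < |(z : ℝ) - H.numEdges|) →
        ((f H).expect fun z => if bad z then 1 else 0) ≤ 16⁻¹) :
    ∃ P : RandomizedGPISAlgorithm V d,
      RandomizedGPISAlgorithm.MakesAtMost P ((k * q : ℕ) : ℝ) ∧
      ∀ H : UniformHypergraph V d, 1 - (2⁻¹ : ℝ) ^ k ≤
        RandomizedGPISAlgorithm.successProb P ε H := by
  classical
  obtain ⟨P, hP, hrun⟩ := (Implementable.sequence_replicate
    (hf.map (fun z : ℝ≥0 => (z : ℝ)) (post' := fun _ => True) fun _ _ => trivial) k).map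
      List.median (post' := fun _ => True) fun _ _ => trivial
  refine ⟨P.map DecisionTree.toAlgorithm, ?_, fun H => ?_⟩
  · intro T hT H
    obtain ⟨T', hT', rfl⟩ := (PMF.mem_support_map_iff _ _ _).1 hT
    exact_mod_cast (DecisionTree.numQueries_toAlgorithm_le H T').trans (hP T' hT').1
  · set a := (1 - ε) * (H.numEdges : ℝ) with ha
    set b := (1 + ε) * (H.numEdges : ℝ) with hb
    rw [RandomizedGPISAlgorithm.successProb, PMF.toReal_toOuterMeasure_eq, PMF.expect_map]
    simp only [DecisionTree.run_toAlgorithm]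
    have h1 := PMF.expect_map P (DecisionTree.run H)
      (fun y : ℝ => if a ≤ y ∧ y ≤ b then (0 : ℝ≥0∞) else 1)
    have h2 : ((f H).map fun z : ℝ≥0 => (z : ℝ)).expect
        (fun z => if a ≤ z ∧ z ≤ b then 0 else 1) ≤ 16⁻¹ := by
      rw [PMF.expect_map]
      refine le_trans (le_of_eq ?_) (hbad H (fun z => ¬ (a ≤ (z : ℝ) ∧ (z : ℝ) ≤ b)) ?_)
      · simp only [ite_not]
      · intro z hz
        by_contra! h
        rw [abs_le] at h
        exact hz ⟨by rw [ha]; linarith [h.1], by rw [hb]; linarith [h.2]⟩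
    have h3 := PMF.expect_median_bad_le _ a b k h2
    have h0 := hrun H
    beta_reduce at h0
    rw [← h0, h1] at h3
    have h4 := ENNReal.toReal_mono (by finiteness) h3
    rw [ENNReal.toReal_pow, ENNReal.toReal_inv, ENNReal.toReal_ofNat] at h4
    linarith

theorem theorem1 (d : ℕ) (hd : 1 ≤ d) (c : ℝ) (hc : 0 < c) :
    ∃ C : ℝ, 0 < C ∧
      ∀ (V : Type*) [Fintype V], 2 ≤ Fintype.card V →
        ∀ ε : ℝ, 0 < ε → ε < 1 →
          ∃ P : RandomizedGPISAlgorithm V d,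
            RandomizedGPISAlgorithm.MakesAtMost P
              (C * (Real.log (Fintype.card V : ℝ)) ^ (5 * d + 5) / ε ^ 4) ∧
            ∀ H : UniformHypergraph V d,
              1 - (Fintype.card V : ℝ) ^ (-c) ≤
                RandomizedGPISAlgorithm.successProb P ε H := by
  classical
  obtain ⟨C, hC, hbound⟩ := query_bound d c hc
  refine ⟨C * 2 ^ (5 * d + 5), by positivity, fun V _ hn ε hε hε1 => ?_⟩
  have : NeZero d := ⟨by omega⟩
  set n := Fintype.card V with hnV
  have hn0 : (0 : ℝ) < n := by exact_mod_cast (by omega : 0 < n)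
  have hlog : 1 / 2 ≤ Real.log n := by
    have h2 : Real.log 2 ≤ Real.log n := Real.log_le_log (by norm_num) (by exact_mod_cast hn)
    linarith [Real.log_two_gt_d9]
  -- The factor `2` ensures `y ≥ 1` already for `n = 2`; it is paid for by `2 ^ (5 * d + 5)` in the
  -- constant.
  set y : ℝ := 2 * Real.log n with hy
  have hy1 : 1 ≤ y := by linarith
  -- The bit length of `n` serves both as the number of rounds and as the number of dyadic rates.
  set L := Nat.log 2 n + 1 with hL
  set R := ⌈(2 : ℝ) ^ d * (d * Real.log n)⌉₊ with hR
  -- Since `2 log 2 ≥ 1`, this many runs give `2 ^ (-k) ≤ n ^ (-c)`.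
  set k := ⌈c * y⌉₊ with hk
  set N := ⌈32 * (((L : ℝ) + 1) * ((R * L ^ d + 1) * (L ^ d + 1) * d ^ d)) / ε ^ 2⌉₊ with hN
  have hd0 : (0 : ℝ) < d := by exact_mod_cast hd
  have hN0 : N ≠ 0 := (Nat.ceil_pos.2 (by positivity)).ne'
  have hnL : n < 2 ^ L := Nat.lt_pow_succ_log_self (by norm_num) n
  have hLy : (L : ℝ) ≤ 2 * y := by
    have h1 : ((2 ^ Nat.log 2 n : ℕ) : ℝ) ≤ n := by
      exact_mod_cast Nat.pow_log_le_self 2 (by omega)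
    have h2 := Real.log_le_log (by positivity) h1
    push_cast at h2
    rw [Real.log_pow] at h2
    have h3 := Real.log_two_gt_d9
    have h4 : (0 : ℝ) ≤ Nat.log 2 n := by positivity
    rw [hL]
    push_cast
    nlinarith
  have hRy : (R : ℝ) ≤ (2 ^ d * d + 1) * y := by
    have h1 : (R : ℝ) < (2 : ℝ) ^ d * (d * Real.log n) + 1 := Nat.ceil_lt_add_one (by positivity)
    have h2 : (0 : ℝ) ≤ 2 ^ d * d * Real.log n := by positivity
    rw [hy] at hy1 ⊢
    nlinarith
  have hky : (k : ℝ) ≤ (c + 1) * y := by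
    have h1 : (k : ℝ) < c * y + 1 := Nat.ceil_lt_add_one (by positivity)
    linarith
  set code : V → ℕ := fun x => (Fintype.equivFin V x : ℕ) with hcode
  have hinj : Function.Injective code := fun x x' h =>
    (Fintype.equivFin V).injective (Fin.ext h)
  obtain ⟨P, hP, hsucc⟩ := exists_algorithm (k := k) (fun H => Box.estimate code N R L L H)
    (Box.implementable_estimate code N R L L) ε fun H bad _ hbad =>
      Box.expect_estimate_bad_le hinj N R L hN0
        (fun x => (Fintype.equivFin V x).2.trans hnL) hnL
        (one_sub_pow_mul_le_one d n R (by omega) (Nat.le_ceil _)) ε hε hε1 (Nat.le_ceil _) H bad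
        hbad
  refine ⟨P, fun T hT H => (hP T hT H).trans ?_, fun H => le_trans ?_ (hsucc H)⟩
  · refine (hbound y ε L R N k hy1 hε hε1 hLy hRy hky
      (Nat.ceil_lt_add_one (by positivity)).le).trans (le_of_eq ?_)
    rw [hy, mul_pow]
    ring
  · have h1 : (2⁻¹ : ℝ) ^ k ≤ (n : ℝ) ^ (-c) := by
      rw [Real.rpow_def_of_pos hn0, inv_pow, ← Real.exp_log (by norm_num : (0 : ℝ) < 2),
        ← Real.exp_nat_mul, ← Real.exp_neg, Real.exp_le_exp]
      have h2 : c * y ≤ k := Nat.le_ceil _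
      have h3 := Real.log_two_gt_d9
      have h4 : 0 < c * Real.log n := by positivity
      rw [hy] at h2
      nlinarith
    linarith
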